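/- Let $N\ge 1$ be an integer, $S_N=\{1,2,\dots,2N\}\subset\mathbb Z$ and $\gamma\in(-1,1)$. For small $\delta>0$ consider the stationary equation on the infinite lattice with a gain/loss defect on $S_N$, $$(1-|W_n|^2)W_n=\delta\left(W_{n+1}+W_{n-1}+i\gamma(-1)^n\chi_{n\in S_N}W_n\right),\qquad n\in\mathbb Z,\tag{1}$$ for $\mathbf W\in l^2(\mathbb Z)$, and the corresponding equation on the finite chain, $$(1-|V_n|^2)V_n=\delta\left(V_{n+1}+V_{n-1}+i\gamma(-1)^nV_n\right),\quad n\in S_N,\qquad V_0=V_{2N+1}=0,\tag{2}$$ for $\mathbf V\in\mathbb C^{2N}$, which is identified with its extension by zero to $\mathbb Z$. A sequence is PT-symmetric if $\mathbf W=P\overline{\mathbf W}$, where $[P\mathbf W]_n=W_{2N+1-n}$, and two sequences are gauge equivalent if one is $e^{i\alpha}$ times the other for some $\alpha\in\mathbb R$. There are $\delta_0>0$ and $C>0$ (which may depend on $N$ and $\gamma$, but not on $\delta$) and families $\mathbf V^{(j)}(\delta)\in\mathbb C^{2N}$ and $\mathbf W^{(j)}(\delta)\in l^2(\mathbb Z)$,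 $1\le j\le 2^N$, with the following properties. 1. (Finite chain.) For each $j$ the map $\delta\mapsto\mathbf V^{(j)}(\delta)$ is $C^\infty$ on $[0,\delta_0)$. For every $\delta\in(0,\delta_0)$, the vectors $\mathbf V^{(1)}(\delta),\dots,\mathbf V^{(2^N)}(\delta)$ are pairwise gauge-inequivalent PT-symmetric solutions of (2) with $\bigl|\sum_{n\in S_N}|V^{(j)}_n(\delta)|^2-2N\bigr|\le C\delta$. Moreover, for every $r\in(0,1)$ and all sufficiently small $\delta>0$ (depending on $r$), each $\mathbf V^{(j)}(\delta)$ satisfies $|V_n|\ge r$ for all $n\in S_N$, and every PT-symmetric solution of (2) with $|V_n|\ge r$ for all $n\in S_N$ is gauge equivalent to some $\mathbf V^{(j)}(\delta)$. 2. (Discrete solitons.) For each $j$ the map $\delta\mapsto\mathbf W^{(j)}(\delta)\in l^2(\mathbb Z)$ is $C^\infty$ on $[0,\delta_0)$. For every $\delta\in(0,\delta_0)$, the sequences $\mathbf W^{(1)}(\delta),\dots,\mathbf W^{(2^N)}(\delta)$ are pairwise gauge-inequivalent PT-symmetric solutions of (1) in $l^2(\mathbb Z)$. Moreover, for every $r\in(0,1)$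 and all sufficiently small $\delta>0$ (depending on $r$), each $\mathbf W^{(j)}(\delta)$ satisfies $|W_n|\ge r$ for $n\in S_N$ and $|W_n|\le r$ for $n\notin S_N$, and every PT-symmetric solution of (1) in $l^2(\mathbb Z)$ with these two properties is gauge equivalent to some $\mathbf W^{(j)}(\delta)$. 3. (Closeness.) $\|\mathbf W^{(j)}(\delta)-\mathbf V^{(j)}(\delta)\|_{l^2(\mathbb Z)}\le C\delta$ for all $j$ and all $\delta\in(0,\delta_0)$. -/

import Mathlib

open scoped ContDiff ENNReal

noncomputable section

namespace PTdNLS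

/-- The set `S_N = {1, 2, …, 2N}` of sites carrying gain and loss. -/
def sites (N : ℕ) : Finset ℤ := Finset.Icc 1 (2 * (N : ℤ))

/-- The space `ℂ^{2N}` of amplitudes on the finite chain `S_N`, with its Euclidean norm. -/
abbrev Chain (N : ℕ) : Type := EuclideanSpace ℂ (sites N)

/-- The Hilbert space `l²(ℤ)` of square-summable complex sequences. -/
abbrev Lattice : Type := lp (fun _ : ℤ => ℂ) 2

/-- Extension by zero of a vector on the finite chain to a sequence on `ℤ`. -/
def zeroExtend {N : ℕ} (V : Chain N) : Lattice :=
  ⟨fun n => if h : n ∈ sites N then V ⟨n, h⟩ else 0, by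
    refine (memℓp_zero ?_).of_exponent_ge (zero_le : (0 : ℝ≥0∞) ≤ 2)
    refine (sites N).finite_toSet.subset fun n hn => ?_
    by_contra h
    exact hn (dif_neg h)⟩

/-- The parity operator `[P u]_n = u_{2N+1-n}`. -/
def parity (N : ℕ) (u : ℤ → ℂ) : ℤ → ℂ := fun n => u (2 * (N : ℤ) + 1 - n)

/-- PT-symmetry of a stationary state: `u = P ū`. -/
def IsPTSymmetric (N : ℕ) (u : ℤ → ℂ) : Prop :=
  u = parity N (fun n => (starRingEnd ℂ) (u n))

/-- Equality up to a gauge transformation `u ↦ e^{iα} u` with `α` real. -/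
def GaugeEquiv (u v : ℤ → ℂ) : Prop :=
  ∃ α : ℝ, ∀ n, u n = Complex.exp (Complex.I * (α : ℂ)) * v n

/-- The rescaled stationary equation on the infinite lattice with the defect on `S_N`:
`(1 - |W_n|²) W_n = δ (W_{n+1} + W_{n-1} + i γ (-1)^n χ_{n ∈ S_N} W_n)` for all `n ∈ ℤ`. -/
def IsLatticeSolution (N : ℕ) (γ δ : ℝ) (W : Lattice) : Prop :=
  ∀ n : ℤ, (1 - (‖W n‖ : ℂ) ^ 2) * W n =
    (δ : ℂ) * (W (n + 1) + W (n - 1) +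
      Complex.I * (γ : ℂ) * (-1 : ℂ) ^ n * (if n ∈ sites N then 1 else 0) * W n)

/-- The rescaled stationary equation on the finite chain:
`(1 - |V_n|²) V_n = δ (V_{n+1} + V_{n-1} + i γ (-1)^n V_n)` for `n ∈ S_N`, where
`V_0 = V_{2N+1} = 0` (these are values of the extension of `V` by zero). -/
def IsChainSolution (N : ℕ) (γ δ : ℝ) (V : Chain N) : Prop :=
  ∀ n ∈ sites N, (1 - (‖zeroExtend V n‖ : ℂ) ^ 2) * zeroExtend V n =
    (δ : ℂ) * (zeroExtend V (n + 1) + zeroExtend V (n - 1) +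
      Complex.I * (γ : ℂ) * (-1 : ℂ) ^ n * zeroExtend V n)

/-- The sequence has amplitude at least `r` at every site of `S_N` and at most `r` elsewhere. -/
def SupportedOnDefect (N : ℕ) (r : ℝ) (u : ℤ → ℂ) : Prop :=
  (∀ n ∈ sites N, r ≤ ‖u n‖) ∧ ∀ n ∉ sites N, ‖u n‖ ≤ r

/-- `V` is the complete list of the `2^N` branches of large-amplitude PT-symmetric stationary
states of the finite chain, for `0 < δ < δ₀`, in the rescaled variables `E = 1/δ`, `w = V/√δ`:
smooth branches of pairwise gauge-inequivalent PT-symmetric solutions satisfying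
`|∑ |V_n|² - 2N| ≤ C δ` (that is, `|∑ |w_n|² - 2 N E| ≤ C`), and, for every `0 < r < 1` and all
sufficiently small `δ`, the only PT-symmetric solutions with all amplitudes at least `r`, up to
gauge. -/
structure IsChainBranches (N : ℕ) (γ δ₀ C : ℝ) (V : Fin (2 ^ N) → ℝ → Chain N) : Prop where
  smooth : ∀ j, ContDiffOn ℝ ∞ (V j) (Set.Ico 0 δ₀)
  solution : ∀ j, ∀ δ ∈ Set.Ioo 0 δ₀, IsChainSolution N γ δ (V j δ)
  symmetric : ∀ j, ∀ δ ∈ Set.Ioo 0 δ₀, IsPTSymmetric N (zeroExtend (V j δ))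
  bound : ∀ j, ∀ δ ∈ Set.Ioo 0 δ₀, |∑ n, ‖V j δ n‖ ^ 2 - 2 * (N : ℝ)| ≤ C * δ
  inequivalent : ∀ j k, ∀ δ ∈ Set.Ioo 0 δ₀,
    GaugeEquiv (zeroExtend (V j δ)) (zeroExtend (V k δ)) → j = k
  complete : ∀ r ∈ Set.Ioo (0 : ℝ) 1, ∃ δ₁ ∈ Set.Ioc 0 δ₀, ∀ δ ∈ Set.Ioo 0 δ₁,
    (∀ j, SupportedOnDefect N r (zeroExtend (V j δ))) ∧
    ∀ U : Chain N, IsChainSolution N γ δ U → IsPTSymmetric N (zeroExtend U) →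
      SupportedOnDefect N r (zeroExtend U) → ∃ j, GaugeEquiv (zeroExtend U) (zeroExtend (V j δ))

/-- `W` is the complete list of the `2^N` branches of discrete solitons supported at the defect,
for `0 < δ < δ₀`: smooth branches in `l²(ℤ)` of pairwise gauge-inequivalent PT-symmetric
solutions, and, for every `0 < r < 1` and all sufficiently small `δ`, the only PT-symmetric
solutions in `l²(ℤ)` with amplitudes at least `r` on `S_N` and at most `r` elsewhere, up to
gauge. -/
structure IsSolitonBranches (N : ℕ) (γ δ₀ : ℝ) (W : Fin (2 ^ N) → ℝ → Lattice) : Prop where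
  smooth : ∀ j, ContDiffOn ℝ ∞ (W j) (Set.Ico 0 δ₀)
  solution : ∀ j, ∀ δ ∈ Set.Ioo 0 δ₀, IsLatticeSolution N γ δ (W j δ)
  symmetric : ∀ j, ∀ δ ∈ Set.Ioo 0 δ₀, IsPTSymmetric N (W j δ)
  inequivalent : ∀ j k, ∀ δ ∈ Set.Ioo 0 δ₀, GaugeEquiv (W j δ) (W k δ) → j = k
  complete : ∀ r ∈ Set.Ioo (0 : ℝ) 1, ∃ δ₁ ∈ Set.Ioc 0 δ₀, ∀ δ ∈ Set.Ioo 0 δ₁,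
    (∀ j, SupportedOnDefect N r (W j δ)) ∧
    ∀ U : Lattice, IsLatticeSolution N γ δ U → IsPTSymmetric N U →
      SupportedOnDefect N r U → ∃ j, GaugeEquiv U (W j δ)

end PTdNLS

end

noncomputable section

namespace PTdNLS

open Filter Topology Complex

/-! PT-symmetry folds the lattice at its centre onto the half-line `m = 0, 1, 2, …` (site `N - m`):
the mirror half carries conjugate amplitudes, so the site `0` has its own conjugate as a neighbour,
and the gauge group is reduced to a sign. A coupling `κ` on the bond at the edge of the defect
treats both problems together: `κ = 1` is the lattice, while `κ = 0` disconnects the finite chain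
from its exterior.

At `δ = 0` the phases on the defect are arbitrary, so the implicit function theorem does not apply
directly. On the defect the equation is therefore multiplied by the conjugate amplitude. The
imaginary part then carries a factor `δ`, which is divided out, leaving a balance of currents that
survives at `δ = 0` (`desingularised`, `isHalfSolution_iff_desingularised`). In the limit the
amplitudes are 1 on the defect and 0 elsewhere, and the balance fixes the imaginary part of every
bond product as `0` or `γ`. Bond products have modulus one and `|γ| < 1`, so each real part is
nonzero with a free sign: this gives `2^N` states up to a global sign (`isBaseState_baseState`,
`exists_eq_baseState`).

Nondegeneracy comes from a triangular structure: linearised currents are determined from the edge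
inwards, then phases from the centre outwards, dividing by the nonzero real parts of the bonds
(`linearised_injective`). Exhaustiveness comes from compactness: a uniform amplitude bound and an
`O(δ)` bound on the exterior force convergence of a subsequence to a limit state, where local
uniqueness applies (`eventually_mem_branch`). Bond products are gauge invariant and separate the
branches. The limit states do not depend on `κ`, so soliton and chain branches start at the same
point and differ by `O(δ)`. -/

/-- The real Hilbert space of square-summable complex sequences on an index set. -/
abbrev Seq (ι : Type) : Type := lp (fun _ : ι => ℂ) 2

/-! ### Bounded real-linear and bilinear operations on square-summable sequences. -/

section Operators

variable {ι κ : Type}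

theorem seq_add_apply (x y : Seq ι) (i : ι) : (x + y) i = x i + y i := rfl

theorem seq_sub_apply (x y : Seq ι) (i : ι) : (x - y) i = x i - y i := rfl

theorem seq_neg_apply (x : Seq ι) (i : ι) : (-x) i = -x i := rfl

theorem seq_zero_apply (i : ι) : (0 : Seq ι) i = 0 := rfl

theorem seq_smul_apply (c : ℝ) (x : Seq ι) (i : ι) : (c • x) i = c * x i :=
  Complex.real_smul

theorem seq_memℓp_mul (x y : Seq ι) : Memℓp (fun i => x i * y i) 2 :=
  ((lp.memℓp y).norm.const_mul ‖x‖).mono fun i => by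
    rw [norm_mul]
    exact mul_le_mul_of_nonneg_right (lp.norm_apply_le_norm two_ne_zero x i) (norm_nonneg _)

/-- Pointwise multiplication of square-summable sequences. -/
def mulL (ι : Type) : Seq ι →L[ℝ] Seq ι →L[ℝ] Seq ι :=
  LinearMap.mkContinuous₂
    (LinearMap.mk₂ ℝ (fun x y : Seq ι => (⟨fun i => x i * y i, seq_memℓp_mul x y⟩ : Seq ι))
      (fun x y z => by ext i; exact add_mul _ _ _)
      (fun c x y => by ext i; exact smul_mul_assoc c (x i) (y i))
      (fun x y z => by ext i; exact mul_add _ _ _)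
      (fun c x y => by ext i; exact mul_smul_comm c (x i) (y i))) 1
    (fun x y => by
      have h : ‖(⟨fun i => x i * y i, seq_memℓp_mul x y⟩ : Seq ι)‖ ≤ ‖‖x‖ • y‖ :=
        lp.norm_mono two_ne_zero fun i => by
          rw [lp.coeFn_smul, Pi.smul_apply, norm_smul, norm_norm]
          change ‖x i * y i‖ ≤ _
          rw [norm_mul]
          exact mul_le_mul_of_nonneg_right (lp.norm_apply_le_norm two_ne_zero x i) (norm_nonneg _)
      rw [norm_smul, norm_norm] at h
      rw [one_mul]
      exact h)

@[simp] theorem mulL_apply (x y : Seq ι) (i : ι) : mulL ι x y i = x i * y i := rfl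

/-- Composition of a square-summable sequence with an injective map of indices. -/
def pullL (σ : ι → κ) (hσ : σ.Injective) : Seq κ →L[ℝ] Seq ι :=
  LinearMap.mkContinuous
    { toFun := fun x => ⟨fun i => x (σ i), memℓp_gen
        (((lp.memℓp x).summable (by norm_num)).comp_injective hσ)⟩
      map_add' := fun x y => rfl
      map_smul' := fun c x => rfl } 1 fun x => by
    rw [one_mul]
    refine lp.norm_le_of_tsum_le (by norm_num) (norm_nonneg _) ?_
    rw [lp.norm_rpow_eq_tsum (by norm_num) x]
    exact tsum_comp_le_tsum_of_inj ((lp.memℓp x).summable (by norm_num))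
      (fun _ => by positivity) hσ

theorem extend_norm_rpow (σ : ι → κ) (hσ : σ.Injective) (x : ι → ℂ) :
    (fun j => ‖Function.extend σ x 0 j‖ ^ (2 : ℝ≥0∞).toReal) =
      Function.extend σ (fun i => ‖x i‖ ^ (2 : ℝ≥0∞).toReal) 0 := by
  funext j
  by_cases h : ∃ i, σ i = j
  · obtain ⟨i, rfl⟩ := h
    rw [hσ.extend_apply, hσ.extend_apply]
  · rw [Function.extend_apply' _ _ _ h, Function.extend_apply' _ _ _ h]
    simp

theorem memℓp_extend (σ : ι → κ) (hσ : σ.Injective) (x : Seq ι) :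
    Memℓp (Function.extend σ x 0) 2 := by
  refine memℓp_gen ?_
  rw [extend_norm_rpow σ hσ]
  exact (summable_extend_zero hσ).2 ((lp.memℓp x).summable (by norm_num))

/-- Transport of a square-summable sequence along an injective map of indices, by zero outside
the range. -/
def pushL (σ : ι → κ) (hσ : σ.Injective) : Seq ι →L[ℝ] Seq κ :=
  LinearMap.mkContinuous
    { toFun := fun x => ⟨Function.extend σ x 0, memℓp_extend σ hσ x⟩
      map_add' := fun x y => by
        ext j
        by_cases h : ∃ i, σ i = j
        · obtain ⟨i, rfl⟩ := h
          change Function.extend σ (x + y : ι → ℂ) 0 (σ i) =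
            Function.extend σ x 0 (σ i) + Function.extend σ y 0 (σ i)
          simp only [hσ.extend_apply, Pi.add_apply]
        · change Function.extend σ (x + y : ι → ℂ) 0 j =
            Function.extend σ x 0 j + Function.extend σ y 0 j
          simp [Function.extend_apply' _ _ _ h]
      map_smul' := fun c x => by
        ext j
        by_cases h : ∃ i, σ i = j
        · obtain ⟨i, rfl⟩ := h
          simp [hσ.extend_apply]
        · simp [Function.extend_apply' _ _ _ h] } 1 fun x => by
    rw [one_mul]
    refine lp.norm_le_of_tsum_le (by norm_num) (norm_nonneg _) ?_
    rw [lp.norm_rpow_eq_tsum (by norm_num) x]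
    change ∑' j, ‖Function.extend σ x 0 j‖ ^ (2 : ℝ≥0∞).toReal ≤ _
    rw [extend_norm_rpow σ hσ, tsum_extend_zero hσ]

@[simp] theorem pushL_apply_self (σ : ι → κ) (hσ : σ.Injective) (x : Seq ι) (i : ι) :
    pushL σ hσ x (σ i) = x i := hσ.extend_apply _ _ _

theorem pushL_apply_of_notMem (σ : ι → κ) (hσ : σ.Injective) (x : Seq ι) (j : κ)
    (h : ¬∃ i, σ i = j) : pushL σ hσ x j = 0 := Function.extend_apply' _ _ _ h

/-- Complex conjugation of square-summable sequences. -/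
def conjL (ι : Type) : Seq ι →L[ℝ] Seq ι :=
  lp.mapCLM 2 (fun _ : ι => (conjCLE : ℂ →L[ℝ] ℂ)) zero_le_one fun _ => by simp

@[simp] theorem conjL_apply (x : Seq ι) (i : ι) : conjL ι x i = (starRingEnd ℂ) (x i) := rfl

/-- Pointwise real part of square-summable sequences. -/
def reL (ι : Type) : Seq ι →L[ℝ] Seq ι :=
  lp.mapCLM 2 (fun _ : ι => ofRealCLM ∘L reCLM) zero_le_one fun _ =>
    (ContinuousLinearMap.opNorm_comp_le _ _).trans (by simp)

@[simp] theorem reL_apply (x : Seq ι) (i : ι) : reL ι x i = ((x i).re : ℂ) := rfl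

/-- Pointwise multiplication by a bounded sequence. -/
def weightL (a : ι → ℂ) (K : ℝ) (hK : 0 ≤ K) (ha : ∀ i, ‖a i‖ ≤ K) : Seq ι →L[ℝ] Seq ι :=
  lp.mapCLM 2 (fun i : ι => ContinuousLinearMap.mul ℝ ℂ (a i)) hK fun i =>
    (ContinuousLinearMap.opNorm_mul_apply_le ℝ ℂ (a i)).trans (ha i)

@[simp] theorem weightL_apply (a : ι → ℂ) (K : ℝ) (hK : 0 ≤ K) (ha : ∀ i, ‖a i‖ ≤ K)
    (x : Seq ι) (i : ι) : weightL a K hK ha x i = a i * x i := rfl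

end Operators

/-! ### The folded equation on the half-line and its desingularisation. -/

section HalfLine

variable (N : ℕ) (γ κ : ℝ)

/-- The coupling between the sites `m` and `m + 1` of the half-line: it is `κ` at the edge of the
defect, and `1` elsewhere. -/
def coupling (m : ℕ) : ℝ := if m + 1 = N then κ else 1

theorem coupling_of_ne {m : ℕ} (h : m + 1 ≠ N) : coupling N κ m = 1 := if_neg h

theorem coupling_one (m : ℕ) : coupling N 1 m = 1 := ite_self _

theorem norm_coupling_le (m : ℕ) : ‖(coupling N κ m : ℂ)‖ ≤ 1 + |κ| := by
  unfold coupling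
  split_ifs
  · simp
  · simp

/-- The gain and loss rate at the site `m` of the half-line. -/
def gain (m : ℕ) : ℝ := γ * (-1) ^ (N + m)

/-- The sum over the neighbours on the half-line, where the left neighbour of the site `0` carries
the conjugate amplitude. -/
def neighbours (x : ℕ → ℂ) : ℕ → ℂ
  | 0 => coupling N κ 0 * x 1 + (starRingEnd ℂ) (x 0)
  | m + 1 => coupling N κ (m + 1) * x (m + 2) + coupling N κ m * x m

/-- The operator `neighbours` on square-summable sequences. -/
def neighboursL : Seq ℕ →L[ℝ] Seq ℕ :=
  weightL (fun m => (coupling N κ m : ℂ)) (1 + |κ|) (by positivity) (norm_coupling_le N κ) ∘L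
      pullL Nat.succ Nat.succ_injective +
    pushL Nat.succ Nat.succ_injective ∘L
      weightL (fun m => (coupling N κ m : ℂ)) (1 + |κ|) (by positivity) (norm_coupling_le N κ) +
    lp.singleContinuousLinearMap ℝ (fun _ : ℕ => ℂ) 2 0 ∘L
      lp.evalCLM ℝ (fun _ : ℕ => ℂ) 2 0 ∘L conjL ℕ

theorem neighboursL_apply (x : Seq ℕ) (m : ℕ) :
    neighboursL N κ x m = neighbours N κ x m := by
  change (coupling N κ m : ℂ) * x (m + 1) +
    pushL Nat.succ Nat.succ_injective
      (weightL (fun m => (coupling N κ m : ℂ)) (1 + |κ|) (by positivity) (norm_coupling_le N κ) x)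
      m + (lp.single 2 0 ((starRingEnd ℂ) (x 0)) : Seq ℕ) m = _
  cases m with
  | zero =>
    rw [pushL_apply_of_notMem _ _ _ _ (by simp), lp.single_apply_self]
    simp [neighbours]
  | succ m =>
    have h := pushL_apply_self Nat.succ Nat.succ_injective
      (weightL (fun m => (coupling N κ m : ℂ)) (1 + |κ|) (by positivity) (norm_coupling_le N κ) x) m
    rw [Nat.succ_eq_add_one] at h
    rw [h, lp.single_apply_ne _ _ _ (Nat.succ_ne_zero m)]
    simp [neighbours]

/-- The stationary equation on the half-line. -/
def IsHalfSolution (δ : ℝ) (x : Seq ℕ) : Prop :=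
  ∀ m, (1 - (‖x m‖ : ℂ) ^ 2) * x m =
    δ * (neighbours N κ x m + (if m < N then I * gain N γ m else 0) * x m)

/-- Restriction to the complement of the defect. -/
def outerL : Seq ℕ →L[ℝ] Seq ℕ :=
  weightL (fun m => if m < N then 0 else 1) 1 zero_le_one fun m => by split_ifs <;> simp

/-- Restriction to the defect. -/
def innerL : Seq ℕ →L[ℝ] Seq ℕ :=
  weightL (fun m => if m < N then 1 else 0) 1 zero_le_one fun m => by split_ifs <;> simp

/-- Multiplication by `i` times the gain and loss rate of the defect. -/
def gainL : Seq ℕ →L[ℝ] Seq ℕ :=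
  weightL (fun m => if m < N then I * gain N γ m else 0) |γ| (abs_nonneg _) fun m => by
    split_ifs
    · simp [gain]
    · simp

/-- The desingularised stationary equation: at the sites of the defect, the real part is the
balance of amplitudes, and the imaginary part is the balance of currents divided by `δ`. -/
def desingularised (p : ℝ × Seq ℕ) : Seq ℕ :=
  outerL N (p.2 - mulL ℕ (mulL ℕ (conjL ℕ p.2) p.2) p.2 - p.1 • neighboursL N κ p.2) +
  innerL N (mulL ℕ (conjL ℕ p.2) p.2 -
    mulL ℕ (mulL ℕ (conjL ℕ p.2) p.2) (mulL ℕ (conjL ℕ p.2) p.2) -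
    p.1 • reL ℕ (mulL ℕ (conjL ℕ p.2) (neighboursL N κ p.2)) +
    (mulL ℕ (conjL ℕ p.2) (neighboursL N κ p.2) -
      reL ℕ (mulL ℕ (conjL ℕ p.2) (neighboursL N κ p.2)))) +
  gainL N γ (mulL ℕ (conjL ℕ p.2) p.2)

/-- The expression is a polynomial in bounded real-linear and bilinear maps. Conjugation and real
parts are only real-linear, hence the scalars `ℝ`. -/
theorem contDiff_desingularised : ContDiff ℝ ω (desingularised N γ κ) := by
  unfold desingularised
  fun_prop

variable {N γ κ}

theorem desingularised_of_le (δ : ℝ) (x : Seq ℕ) {m : ℕ} (hm : N ≤ m) :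
    desingularised N γ κ (δ, x) m =
      x m - (starRingEnd ℂ) (x m) * x m * x m - δ * neighbours N κ x m := by
  rw [← neighboursL_apply]
  simp only [desingularised, outerL, innerL, gainL, seq_add_apply, seq_sub_apply, seq_smul_apply,
    weightL_apply, mulL_apply, conjL_apply, reL_apply, if_false, not_lt.2 hm, zero_mul, one_mul,
    add_zero]

theorem desingularised_of_lt (δ : ℝ) (x : Seq ℕ) {m : ℕ} (hm : m < N) :
    desingularised N γ κ (δ, x) m =
      (starRingEnd ℂ) (x m) * x m - (starRingEnd ℂ) (x m) * x m * ((starRingEnd ℂ) (x m) * x m) -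
      δ * ((((starRingEnd ℂ) (x m) * neighbours N κ x m).re : ℝ) : ℂ) +
      ((starRingEnd ℂ) (x m) * neighbours N κ x m -
        ((((starRingEnd ℂ) (x m) * neighbours N κ x m).re : ℝ) : ℂ)) +
      I * gain N γ m * ((starRingEnd ℂ) (x m) * x m) := by
  rw [← neighboursL_apply]
  simp only [desingularised, outerL, innerL, gainL, seq_add_apply, seq_sub_apply, seq_smul_apply,
    weightL_apply, mulL_apply, conjL_apply, reL_apply, if_true, hm, zero_mul, one_mul,
    zero_add]

theorem re_desingularised (δ : ℝ) (x : Seq ℕ) {m : ℕ} (hm : m < N) :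
    (desingularised N γ κ (δ, x) m).re =
      (1 - normSq (x m)) * normSq (x m) - δ * ((starRingEnd ℂ) (x m) * neighbours N κ x m).re := by
  rw [desingularised_of_lt δ x hm]
  simp [normSq_apply]
  ring

theorem im_desingularised (δ : ℝ) (x : Seq ℕ) {m : ℕ} (hm : m < N) :
    (desingularised N γ κ (δ, x) m).im =
      ((starRingEnd ℂ) (x m) * neighbours N κ x m).im + gain N γ m * normSq (x m) := by
  rw [desingularised_of_lt δ x hm]
  simp [normSq_apply]
  ring

/-- On the defect, multiplication by the nonzero conjugate amplitude is reversible, and so is the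
division of the imaginary part by `δ ≠ 0`. Outside the defect nothing has been changed. -/
theorem isHalfSolution_iff_desingularised {δ : ℝ} (hδ : δ ≠ 0) {x : Seq ℕ}
    (hx : ∀ m < N, x m ≠ 0) :
    IsHalfSolution N γ κ δ x ↔ desingularised N γ κ (δ, x) = 0 := by
  rw [lp.ext_iff, funext_iff]
  refine forall_congr' fun m => ?_
  rw [lp.coeFn_zero, Pi.zero_apply, ← ofReal_pow, ← normSq_eq_norm_sq]
  by_cases hm : m < N
  · rw [if_pos hm, ← sub_eq_zero,
      ← mul_right_inj' (show (starRingEnd ℂ) (x m) ≠ 0 by simpa using hx m hm), mul_zero,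
      Complex.ext_iff, Complex.ext_iff, re_desingularised δ x hm, im_desingularised δ x hm]
    refine and_congr ?_ ?_
    · rw [← sub_eq_zero, eq_comm, ← sub_eq_zero]
      simp [normSq_apply]
      ring_nf
      constructor <;> intro h <;> linear_combination -h
    -- The nonlinear term times the conjugate amplitude is real, so the imaginary part is exactly
    -- `-δ` times the current balance.
    · rw [← mul_right_inj' (b := ((starRingEnd ℂ) (x m) * neighbours N κ x m).im + _)
        (neg_ne_zero.2 hδ)]
      simp [normSq_apply, -mul_eq_zero, -neg_eq_zero]
      ring_nf
  · rw [if_neg hm, desingularised_of_le δ x (not_lt.1 hm), ← sub_eq_zero, zero_mul, add_zero,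
      ← mul_conj]
    ring_nf

end HalfLine

/-! ### Invertibility of the linearisation at a nondegenerate limit state. -/

section Linearisation

variable {N : ℕ} {γ κ : ℝ}

/-- The bond products of a sequence on the half-line, the first bond being the one across the
axis of symmetry. -/
def bond (x : ℕ → ℂ) : ℕ → ℂ
  | 0 => (starRingEnd ℂ) (x 0) * (starRingEnd ℂ) (x 0)
  | m + 1 => (starRingEnd ℂ) (x (m + 1)) * x m

variable (N γ κ) in
/-- A nondegenerate state of the anticontinuum limit. -/
structure IsBaseState (x : Seq ℕ) : Prop where
  outer : ∀ m, N ≤ m → x m = 0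
  inner : ∀ m < N, normSq (x m) = 1
  balance : ∀ m < N,
    ((starRingEnd ℂ) (x m) * neighbours N κ x m).im + gain N γ m = 0
  bond_re : ∀ m < N, (bond x m).re ≠ 0

theorem IsBaseState.desingularised_eq_zero {x : Seq ℕ} (hx : IsBaseState N γ κ x) :
    desingularised N γ κ (0, x) = 0 := by
  refine lp.ext (funext fun m => ?_)
  rw [seq_zero_apply]
  by_cases hm : m < N
  · apply Complex.ext
    · rw [re_desingularised _ _ hm, hx.inner m hm]
      simp
    · rw [im_desingularised _ _ hm, hx.inner m hm, mul_one, hx.balance m hm]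
      simp
  · rw [desingularised_of_le _ _ (not_lt.1 hm), hx.outer m (not_lt.1 hm)]
    simp

/-- Along a line, the real and imaginary parts of the equation on the defect are polynomials of
degree at most four in the parameter, so their derivatives can be read off as linear coefficients.
-/
theorem hasDerivAt_quartic (a b c d e : ℝ) :
    HasDerivAt (fun t : ℝ => a + t * b + t ^ 2 * (c + t * d + t ^ 2 * e)) b 0 := by
  have h1 := ((hasDerivAt_id (0 : ℝ)).mul_const b).const_add a
  have h2 := ((((hasDerivAt_id (0 : ℝ)).mul_const d).const_add c).add
    (((hasDerivAt_id (0 : ℝ)).pow 2).mul_const e))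
  have h3 := h1.add (((hasDerivAt_id (0 : ℝ)).pow 2).mul h2)
  convert! h3 using 1
  simp

variable (N γ κ) in
/-- The derivative of the desingularised equation in the sequence at `δ = 0`. -/
def linearised (x : Seq ℕ) : Seq ℕ →L[ℝ] Seq ℕ :=
  fderiv ℝ (desingularised N γ κ) (0, x) ∘L .inr ℝ ℝ (Seq ℕ)

theorem hasDerivAt_linearised (x h : Seq ℕ) (m : ℕ) :
    HasDerivAt (fun t : ℝ => desingularised N γ κ (0, x + t • h) m) (linearised N γ κ x h m) 0 := by
  have h1 : HasDerivAt (fun t : ℝ => ((0 : ℝ), x + t • h)) (0, h) 0 := by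
    refine (hasDerivAt_const (0 : ℝ) (0 : ℝ)).prodMk ?_
    simpa using ((hasDerivAt_id (0 : ℝ)).smul_const h).const_add x
  have h2 : HasFDerivAt (desingularised N γ κ) (fderiv ℝ (desingularised N γ κ) (0, x))
      ((0 : ℝ), x + (0 : ℝ) • h) := by
    rw [zero_smul, add_zero]
    exact ((contDiff_desingularised N γ κ).differentiable (by simp)).differentiableAt.hasFDerivAt
  exact (lp.evalCLM ℝ (fun _ : ℕ => ℂ) 2 m).hasFDerivAt.comp_hasDerivAt (0 : ℝ)
    (h2.comp_hasDerivAt (0 : ℝ) h1)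

theorem neighbours_add_smul (x h : Seq ℕ) (t : ℝ) (m : ℕ) :
    neighbours N κ (x + t • h : Seq ℕ) m = neighbours N κ x m + t * neighbours N κ h m := by
  rw [← neighboursL_apply, ← neighboursL_apply, ← neighboursL_apply, map_add, map_smul,
    seq_add_apply, seq_smul_apply]

/-- The base state vanishes outside the defect, so the cubic term contributes only at third order
and the coupling is switched off at `δ = 0`. -/
theorem linearised_of_le {x : Seq ℕ} (hx : IsBaseState N γ κ x) (h : Seq ℕ) {m : ℕ} (hm : N ≤ m) :
    linearised N γ κ x h m = h m := by
  have h0 := hasDerivAt_linearised (N := N) (γ := γ) (κ := κ) x h m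
  refine h0.unique ?_
  have h1 : (fun t : ℝ => desingularised N γ κ (0, x + t • h) m) =
      fun t : ℝ => (t : ℂ) * h m + (t : ℂ) ^ 3 * (-(starRingEnd ℂ) (h m) * h m * h m) := by
    funext t
    rw [desingularised_of_le _ _ hm, seq_add_apply, seq_smul_apply, hx.outer m hm]
    simp
    ring
  rw [h1]
  have h2 := (hasDerivAt_id (0 : ℝ)).ofReal_comp
  have h3 := (h2.mul_const (h m)).add
    ((h2.pow 3).mul_const (-(starRingEnd ℂ) (h m) * h m * h m))
  convert! h3 using 1
  simp

theorem re_linearised {x : Seq ℕ} (hx : IsBaseState N γ κ x) (h : Seq ℕ) {m : ℕ} (hm : m < N) :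
    (linearised N γ κ x h m).re = -2 * ((starRingEnd ℂ) (x m) * h m).re := by
  have h0 := reCLM.hasFDerivAt.comp_hasDerivAt (0 : ℝ)
    (hasDerivAt_linearised (N := N) (γ := γ) (κ := κ) x h m)
  have h2 : normSq (x m) = 1 := hx.inner m hm
  refine h0.unique ?_
  have h1 : reCLM ∘ (fun t : ℝ => desingularised N γ κ (0, x + t • h) m) =
      fun t : ℝ => 0 + t * (-2 * ((starRingEnd ℂ) (x m) * h m).re) +
        t ^ 2 * ((-normSq (h m) - 4 * ((starRingEnd ℂ) (x m) * h m).re ^ 2) +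
          t * (-4 * ((starRingEnd ℂ) (x m) * h m).re * normSq (h m)) +
          t ^ 2 * (-normSq (h m) ^ 2)) := by
    funext t
    change (desingularised N γ κ (0, x + t • h) m).re = _
    rw [re_desingularised _ _ hm]
    have h3 : normSq ((x + t • h : Seq ℕ) m) =
        normSq (x m) + t * (2 * ((starRingEnd ℂ) (x m) * h m).re) + t ^ 2 * normSq (h m) := by
      rw [seq_add_apply, seq_smul_apply]
      simp [normSq_apply]
      ring
    rw [h3, h2]
    ring
  rw [h1]
  exact hasDerivAt_quartic _ _ _ _ _

theorem im_linearised (x h : Seq ℕ) {m : ℕ} (hm : m < N) :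
    (linearised N γ κ x h m).im =
      ((starRingEnd ℂ) (h m) * neighbours N κ x m + (starRingEnd ℂ) (x m) * neighbours N κ h m).im +
        2 * gain N γ m * ((starRingEnd ℂ) (x m) * h m).re := by
  have h0 := imCLM.hasFDerivAt.comp_hasDerivAt (0 : ℝ)
    (hasDerivAt_linearised (N := N) (γ := γ) (κ := κ) x h m)
  refine h0.unique ?_
  convert! hasDerivAt_quartic
    (((starRingEnd ℂ) (x m) * neighbours N κ x m).im + gain N γ m * normSq (x m)) _
    (((starRingEnd ℂ) (h m) * neighbours N κ h m).im + gain N γ m * normSq (h m)) 0 0 using 1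
  funext t
  change (desingularised N γ κ (0, x + t • h) m).im = _
  rw [im_desingularised _ _ hm, neighbours_add_smul, seq_add_apply, seq_smul_apply]
  simp [normSq_apply]
  ring

variable (N κ) in
/-- The linearisation of the currents, polarised. -/
def linearCurrent (x h : ℕ → ℂ) : ℕ → ℝ
  | 0 => 2 * ((starRingEnd ℂ) (x 0) * (starRingEnd ℂ) (h 0)).im
  | m + 1 => coupling N κ m *
      ((starRingEnd ℂ) (h (m + 1)) * x m + (starRingEnd ℂ) (x (m + 1)) * h m).im

/-- Symmetric hopping turns the neighbour terms into a discrete divergence: each bond current leaves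
one site and enters the next. The factor 2 on the bond across the axis arises because both of its
ends carry the same amplitude up to conjugation. -/
theorem linearCurrent_sub (x h : ℕ → ℂ) (m : ℕ) :
    ((starRingEnd ℂ) (h m) * neighbours N κ x m + (starRingEnd ℂ) (x m) * neighbours N κ h m).im =
      linearCurrent N κ x h m - linearCurrent N κ x h (m + 1) := by
  cases m with
  | zero => simp [neighbours, linearCurrent]; ring
  | succ m => simp [neighbours, linearCurrent]; ring

/-- A perturbation tangent to the unit circle is `h = iφz` with `φ` real, and it changes the
imaginary part of the bond by `-φ` times the real part, which is nonzero. -/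
theorem eq_zero_of_tangent {z h b : ℂ} (hz : normSq z = 1) (hre : ((starRingEnd ℂ) z * h).re = 0)
    (hb : ((starRingEnd ℂ) z * b).re ≠ 0) (him : ((starRingEnd ℂ) h * b).im = 0) : h = 0 := by
  obtain ⟨φ, hφ⟩ : ∃ φ : ℝ, (starRingEnd ℂ) z * h = I * φ := by
    refine ⟨((starRingEnd ℂ) z * h).im, ?_⟩
    apply Complex.ext
    · rw [hre]; simp
    · simp
  have h1 : h = I * φ * z := by
    have h2 : z * (starRingEnd ℂ) z = 1 := by rw [mul_conj, hz]; simp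
    rw [← hφ]
    linear_combination -h * h2
  have h3 : φ * ((starRingEnd ℂ) z * b).re = 0 := by
    rw [h1] at him
    simp [-mul_eq_zero] at him ⊢
    linear_combination -him
  rcases mul_eq_zero.1 h3 with h4 | h4
  · rw [h1, h4]; simp
  · exact absurd h4 hb

theorem linearised_injective (hN : 1 ≤ N) {x : Seq ℕ} (hx : IsBaseState N γ κ x) {h : Seq ℕ}
    (h0 : linearised N γ κ x h = 0) : h = 0 := by
  have hout : ∀ m, N ≤ m → h m = 0 := fun m hm => by
    rw [← linearised_of_le hx h hm, h0, seq_zero_apply]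
  have hre : ∀ m < N, ((starRingEnd ℂ) (x m) * h m).re = 0 := fun m hm => by
    have := re_linearised hx h hm
    rw [h0, seq_zero_apply, zero_re] at this
    linarith
  -- Both sequences vanish at the site `N`, so no linearised current crosses the edge of the defect.
  -- The balance equations carry this inwards to the centre.
  have hcur : ∀ k ≤ N, linearCurrent N κ x h (N - k) = 0 := by
    intro k
    induction k with
    | zero =>
      intro _
      obtain ⟨n, rfl⟩ : ∃ n, N = n + 1 := ⟨N - 1, by omega⟩
      simp [linearCurrent, hout (n + 1) le_rfl, hx.outer (n + 1) le_rfl]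
    | succ k ih =>
      intro hk
      have h1 := im_linearised (γ := γ) (κ := κ) x h (show N - (k + 1) < N by omega)
      rw [h0, seq_zero_apply, zero_im, linearCurrent_sub, hre _ (by omega),
        show N - (k + 1) + 1 = N - k by omega, ih (by omega)] at h1
      linarith
  -- With all currents zero, phases are killed from the centre outwards. The bond across the axis
  -- pins the first phase itself, since PT-symmetry leaves no continuous gauge freedom.
  have hin : ∀ m < N, h m = 0 := by
    intro m
    induction m with
    | zero =>
      intro hm
      refine eq_zero_of_tangent (b := (starRingEnd ℂ) (x 0)) (hx.inner 0 hm) (hre 0 hm)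
        (hx.bond_re 0 hm) ?_
      have h1 := hcur N le_rfl
      rw [Nat.sub_self] at h1
      rw [mul_comm]
      simpa only [linearCurrent, mul_eq_zero, two_ne_zero, false_or] using h1
    | succ m ih =>
      intro hm
      refine eq_zero_of_tangent (b := x m) (hx.inner _ hm) (hre _ hm) (hx.bond_re _ hm) ?_
      have h1 := hcur (N - (m + 1)) (by omega)
      rw [show N - (N - (m + 1)) = m + 1 by omega] at h1
      simpa [linearCurrent, ih (by omega), coupling_of_ne N κ (show m + 1 ≠ N by omega)] using h1
  refine lp.ext (funext fun m => ?_)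
  by_cases hm : m < N
  · exact hin m hm
  · exact hout m (not_lt.1 hm)

variable (N) in
/-- The extension by zero of finitely many amplitudes to the half-line. -/
def finiteL : (Fin N → ℂ) →L[ℝ] Seq ℕ :=
  ∑ i : Fin N, lp.singleContinuousLinearMap ℝ (fun _ : ℕ => ℂ) 2 (i : ℕ) ∘L .proj i

theorem finiteL_apply (c : Fin N → ℂ) (m : ℕ) :
    finiteL N c m = if h : m < N then c ⟨m, h⟩ else 0 := by
  have h1 : finiteL N c = ∑ i : Fin N, (lp.single 2 (i : ℕ) (c i) : Seq ℕ) := by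
    rw [finiteL, sum_apply]
    rfl
  rw [h1, lp.coeFn_sum, Finset.sum_apply]
  split_ifs with h
  · rw [Finset.sum_eq_single ⟨m, h⟩]
    · exact lp.single_apply_self _ _ _
    · intro i _ hi
      exact lp.single_apply_ne _ _ _ fun h' => hi (Fin.ext h'.symm)
    · simp
  · refine Finset.sum_eq_zero fun i _ => lp.single_apply_ne _ _ _ fun h' => h ?_
    rw [h']
    exact i.2

/-- The linearisation is the identity on exterior entries, so those of `y` can be copied. What
remains is an injective real-linear endomorphism of a finite-dimensional space, hence a surjective
one. -/
theorem linearised_surjective (hN : 1 ≤ N) {x : Seq ℕ} (hx : IsBaseState N γ κ x) (y : Seq ℕ) :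
    ∃ h, linearised N γ κ x h = y := by
  let A : (Fin N → ℂ) →ₗ[ℝ] (Fin N → ℂ) :=
    { toFun := fun c i => linearised N γ κ x (finiteL N c) i
      map_add' := fun c d => by
        funext i
        rw [map_add, map_add]
        rfl
      map_smul' := fun a c => by
        funext i
        rw [map_smul, map_smul]
        rfl }
  have hker : Function.Injective A := by
    refine (injective_iff_map_eq_zero A).2 fun c hc => ?_
    have h1 : finiteL N c = 0 := by
      refine linearised_injective hN hx (lp.ext (funext fun m => ?_))
      by_cases hm : m < N
      · exact congrFun hc ⟨m, hm⟩
      · rw [linearised_of_le hx _ (not_lt.1 hm), finiteL_apply, dif_neg hm, seq_zero_apply]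
    funext i
    have h2 := finiteL_apply c i
    rw [dif_pos i.2, h1] at h2
    exact h2.symm
  obtain ⟨c, hc⟩ := (LinearMap.injective_iff_surjective.1 hker)
    (fun i => (y - linearised N γ κ x (outerL N y)) i)
  refine ⟨outerL N y + finiteL N c, lp.ext (funext fun m => ?_)⟩
  rw [map_add, seq_add_apply]
  by_cases hm : m < N
  · have h1 := congrFun hc ⟨m, hm⟩
    change linearised N γ κ x (finiteL N c) m = _ - _ at h1
    rw [h1]
    ring
  · rw [linearised_of_le hx _ (not_lt.1 hm), linearised_of_le hx _ (not_lt.1 hm), finiteL_apply,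
      dif_neg hm]
    simp [outerL, hm]

theorem linearised_isInvertible (hN : 1 ≤ N) {x : Seq ℕ} (hx : IsBaseState N γ κ x) :
    (linearised N γ κ x).IsInvertible :=
  ⟨ContinuousLinearEquiv.ofBijective (linearised N γ κ x)
    (LinearMap.ker_eq_bot'.2 fun _ => linearised_injective hN hx)
    (LinearMap.range_eq_top.2 fun y => linearised_surjective hN hx y),
    ContinuousLinearEquiv.coe_ofBijective _ _ _⟩

/-- Continuation of a nondegenerate state from the anticontinuum limit. -/
theorem IsBaseState.exists_branch (hN : 1 ≤ N) {x : Seq ℕ} (hx : IsBaseState N γ κ x) :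
    ∃ X : ℝ → Seq ℕ, X 0 = x ∧ ContDiffAt ℝ ω X 0 ∧
      (∀ᶠ δ in 𝓝 0, desingularised N γ κ (δ, X δ) = 0) ∧
      ∀ᶠ p in 𝓝 ((0 : ℝ), x), desingularised N γ κ p = 0 → p.2 = X p.1 := by
  have hc : ContDiffAt ℝ ω (desingularised N γ κ) (0, x) :=
    (contDiff_desingularised N γ κ).contDiffAt
  have hω : (ω : WithTop ℕ∞) ≠ 0 := by simp
  have hi := linearised_isInvertible hN hx
  refine ⟨hc.implicitFunction hω hi, hc.implicitFunction_apply_self hω hi,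
    hc.contDiffAt_implicitFunction hω hi, ?_, ?_⟩
  · simpa only [hx.desingularised_eq_zero] using hc.eventually_apply_implicitFunction hω hi
  · filter_upwards [hc.eventually_apply_eq_iff_implicitFunction hω hi] with p hp h0
    exact (hp.1 (h0.trans hx.desingularised_eq_zero.symm)).symm

end Linearisation

/-! ### The `2^N` limit states and their classification. -/

section BaseStates

variable {N : ℕ} {γ κ : ℝ}

variable (N) in
/-- The currents of a sequence supported on the defect. -/
def current (x : ℕ → ℂ) (m : ℕ) : ℝ := if m < N then (bond x m).im else 0

/-- The polarised current on the diagonal is twice the current, so the divergence formula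
specialises. The hypothesis `x N = 0` removes the flux through the edge, whatever `κ` is. -/
theorem im_conj_mul_neighbours {x : ℕ → ℂ} (hx : x N = 0) {m : ℕ} (hm : m < N) :
    ((starRingEnd ℂ) (x m) * neighbours N κ x m).im = current N x m - current N x (m + 1) := by
  have h1 : ∀ k ≤ N, 1 ≤ N → linearCurrent N κ x x k = 2 * current N x k := by
    intro k hk hN
    cases k with
    | zero => simp only [linearCurrent, current, bond, if_pos (show 0 < N by omega)]
    | succ k =>
      by_cases h : k + 1 < N
      · simp only [linearCurrent, current, if_pos h, bond,
          coupling_of_ne N κ (show k + 1 ≠ N by omega), one_mul, add_im]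
        ring
      · have h2 : k + 1 = N := by omega
        subst h2
        simp [linearCurrent, current, hx]
  have h2 := linearCurrent_sub (N := N) (κ := κ) x x m
  rw [h1 m hm.le (by omega), h1 (m + 1) hm (by omega), add_im] at h2
  linarith

variable (N γ) in
/-- The currents of the states of the anticontinuum limit. -/
def baseCurrent (m : ℕ) : ℝ := if Odd (N + m) then γ else 0

theorem baseCurrent_self : baseCurrent N γ N = 0 := by simp [baseCurrent]

theorem baseCurrent_sub (m : ℕ) :
    baseCurrent N γ m - baseCurrent N γ (m + 1) + gain N γ m = 0 := by
  unfold baseCurrent gain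
  rcases Nat.even_or_odd (N + m) with h | h
  · rw [if_neg (Nat.not_odd_iff_even.2 h), if_pos (by rw [← add_assoc]; exact h.add_one),
      h.neg_one_pow]
    ring
  · rw [if_pos h, if_neg (by rw [← add_assoc, Nat.not_odd_iff_even]; exact h.add_one),
      h.neg_one_pow]
    ring

theorem baseCurrent_sq_lt (hγ : γ ∈ Set.Ioo (-1 : ℝ) 1) (m : ℕ) : baseCurrent N γ m ^ 2 < 1 := by
  unfold baseCurrent
  split_ifs
  · nlinarith [hγ.1, hγ.2]
  · norm_num

/-- The sign attached to a site of the half-line. -/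
def signAt (s : Fin N → Bool) (m : ℕ) : ℝ :=
  if h : m < N then (if s ⟨m, h⟩ then 1 else -1) else 1

theorem signAt_sq (s : Fin N → Bool) (m : ℕ) : signAt s m ^ 2 = 1 := by
  unfold signAt
  split_ifs <;> norm_num

variable (γ) in
/-- The bond products of the states of the anticontinuum limit. -/
def bondValue (s : Fin N → Bool) (m : ℕ) : ℂ :=
  ⟨signAt s m * √(1 - baseCurrent N γ m ^ 2), baseCurrent N γ m⟩

theorem normSq_bondValue (hγ : γ ∈ Set.Ioo (-1 : ℝ) 1) (s : Fin N → Bool) (m : ℕ) :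
    normSq (bondValue γ s m) = 1 := by
  have h := Real.sq_sqrt (sub_nonneg.2 (baseCurrent_sq_lt (N := N) hγ m).le)
  rw [normSq_apply]
  simp only [bondValue]
  linear_combination (√(1 - baseCurrent N γ m ^ 2)) ^ 2 * signAt_sq s m + h

theorem bondValue_re_ne_zero (hγ : γ ∈ Set.Ioo (-1 : ℝ) 1) (s : Fin N → Bool) (m : ℕ) :
    (bondValue γ s m).re ≠ 0 := by
  refine mul_ne_zero ?_ (Real.sqrt_pos.2 (sub_pos.2 (baseCurrent_sq_lt hγ m))).ne'
  intro h
  simpa [h] using signAt_sq s m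

theorem bondValue_injective (hγ : γ ∈ Set.Ioo (-1 : ℝ) 1) {s s' : Fin N → Bool}
    (h : ∀ m < N, bondValue γ s m = bondValue γ s' m) : s = s' := by
  funext i
  have h1 : signAt s i = signAt s' i :=
    mul_right_cancel₀ (Real.sqrt_pos.2 (sub_pos.2 (baseCurrent_sq_lt (N := N) hγ i))).ne'
      (congrArg re (h i i.2))
  simp only [signAt, i.2, dif_pos] at h1
  revert h1
  cases s i <;> cases s' i <;> norm_num

variable (γ) in
/-- The phase factors of the states of the anticontinuum limit. -/
def phase (s : Fin N → Bool) : ℕ → ℂ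
  | 0 => (starRingEnd ℂ) (bondValue γ s 0 ^ (((2 : ℕ) : ℂ)⁻¹))
  | m + 1 => (starRingEnd ℂ) (bondValue γ s (m + 1)) * phase s m

theorem normSq_phase (hγ : γ ∈ Set.Ioo (-1 : ℝ) 1) (s : Fin N → Bool) (m : ℕ) :
    normSq (phase γ s m) = 1 := by
  induction m with
  | zero =>
    have h := congrArg normSq (cpow_nat_inv_pow (bondValue γ s 0) two_ne_zero)
    rw [map_pow, normSq_bondValue hγ] at h
    rw [phase, normSq_conj]
    exact (pow_eq_one_iff_of_nonneg (normSq_nonneg _) two_ne_zero).1 h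
  | succ m ih => rw [phase, map_mul, normSq_conj, normSq_bondValue hγ, ih, one_mul]

/-- The central bond is the square of a conjugate amplitude, so the construction starts from a
complex square root. Each further bond fixes the next phase because the previous one is unimodular.
-/
theorem bond_phase (hγ : γ ∈ Set.Ioo (-1 : ℝ) 1) (s : Fin N → Bool) (m : ℕ) :
    bond (phase γ s) m = bondValue γ s m := by
  cases m with
  | zero => rw [bond, phase, conj_conj, ← pow_two, cpow_nat_inv_pow _ two_ne_zero]
  | succ m =>
    rw [bond, phase, map_mul, conj_conj, mul_assoc, ← normSq_eq_conj_mul_self, normSq_phase hγ]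
    simp

variable (γ) in
/-- The states of the anticontinuum limit on the half-line. -/
def baseState (s : Fin N → Bool) : Seq ℕ := finiteL N fun i => phase γ s i

theorem baseState_of_lt (s : Fin N → Bool) {m : ℕ} (hm : m < N) :
    baseState γ s m = phase γ s m := by
  rw [baseState, finiteL_apply, dif_pos hm]

theorem baseState_of_le (s : Fin N → Bool) {m : ℕ} (hm : N ≤ m) : baseState γ s m = 0 := by
  rw [baseState, finiteL_apply, dif_neg (not_lt.2 hm)]

theorem bond_congr {x y : ℕ → ℂ} (h : ∀ m < N, x m = y m) {m : ℕ} (hm : m < N) :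
    bond x m = bond y m := by
  cases m with
  | zero => rw [bond, bond, h 0 hm]
  | succ m => rw [bond, bond, h _ hm, h m (by omega)]

theorem bond_baseState (hγ : γ ∈ Set.Ioo (-1 : ℝ) 1) (s : Fin N → Bool) {m : ℕ} (hm : m < N) :
    bond (baseState γ s) m = bondValue γ s m := by
  rw [← bond_phase hγ s m]
  exact bond_congr (fun _ => baseState_of_lt s) hm

theorem isBaseState_baseState (hγ : γ ∈ Set.Ioo (-1 : ℝ) 1) (s : Fin N → Bool) :
    IsBaseState N γ κ (baseState γ s) where
  outer m hm := baseState_of_le s hm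
  inner m hm := by rw [baseState_of_lt s hm, normSq_phase hγ]
  balance m hm := by
    have h1 : ∀ k ≤ N, current N (baseState γ s) k = baseCurrent N γ k := by
      intro k hk
      unfold current
      split_ifs with h
      · rw [bond_baseState hγ s h]
        rfl
      · rw [show k = N by omega, baseCurrent_self]
    rw [im_conj_mul_neighbours (baseState_of_le s le_rfl) hm, h1 m hm.le, h1 (m + 1) hm]
    exact baseCurrent_sub m
  bond_re m hm := by
    rw [bond_baseState hγ s hm]
    exact bondValue_re_ne_zero hγ s m

/-- Dividing each bond by the preceding nonzero amplitude yields the next amplitude, so the central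
value and the bonds determine everything. -/
theorem eq_of_bond_eq {x y : ℕ → ℂ} (hx : ∀ m < N, x m ≠ 0) (h0 : 0 < N → x 0 = y 0)
    (h : ∀ m < N, bond x m = bond y m) : ∀ m < N, x m = y m := by
  intro m
  induction m with
  | zero => exact h0
  | succ m ih =>
    intro hm
    have h1 := h (m + 1) hm
    rw [bond, bond, ih (by omega)] at h1
    have h2 : y m ≠ 0 := ih (by omega) ▸ hx m (by omega)
    exact (starRingEnd ℂ).injective (mul_right_cancel₀ h2 h1)

/-- Classification of the states of the anticontinuum limit. -/
theorem exists_eq_baseState (hγ : γ ∈ Set.Ioo (-1 : ℝ) 1) {r : ℝ} (hr : r ∈ Set.Ioo (0 : ℝ) 1)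
    {x : Seq ℕ} (hx : desingularised N γ κ (0, x) = 0) (hin : ∀ m < N, r ≤ ‖x m‖)
    (hout : ∀ m, N ≤ m → ‖x m‖ ≤ r) :
    ∃ s : Fin N → Bool, x = baseState γ s ∨ -x = baseState γ s := by
  have hx0 : ∀ m < N, x m ≠ 0 := fun m hm => norm_pos_iff.1 (hr.1.trans_le (hin m hm))
  have hunit : ∀ m < N, normSq (x m) = 1 := by
    intro m hm
    have h1 := re_desingularised (N := N) (γ := γ) (κ := κ) 0 x hm
    rw [hx, seq_zero_apply, zero_re, zero_mul, sub_zero, eq_comm, mul_eq_zero] at h1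
    rcases h1 with h1 | h1
    · linarith
    · exact absurd (normSq_eq_zero.1 h1) (hx0 m hm)
  have hzero : ∀ m, N ≤ m → x m = 0 := by
    intro m hm
    have h1 := desingularised_of_le (γ := γ) (κ := κ) 0 x hm
    rw [hx, seq_zero_apply, ofReal_zero, zero_mul, sub_zero, ← normSq_eq_conj_mul_self] at h1
    have h2 : (1 - normSq (x m) : ℂ) * x m = 0 := by linear_combination -h1
    -- At `δ = 0` an exterior amplitude is 0 or of modulus 1, and the bound by `r < 1` excludes the
    -- latter.
    rcases mul_eq_zero.1 h2 with h3 | h3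
    · exfalso
      have h4 : normSq (x m) = 1 := by exact_mod_cast (sub_eq_zero.1 h3).symm
      rw [normSq_eq_norm_sq] at h4
      nlinarith [hout m hm, hr.1, hr.2, norm_nonneg (x m)]
    · exact h3
  -- The same recurrence as for the explicit currents, solved inwards from zero flux at the edge.
  have hcur : ∀ k ≤ N, current N x (N - k) = baseCurrent N γ (N - k) := by
    intro k
    induction k with
    | zero =>
      intro _
      rw [Nat.sub_zero, baseCurrent_self, current, if_neg (lt_irrefl N)]
    | succ k ih =>
      intro hk
      have hm : N - (k + 1) < N := by omega
      have h1 := im_desingularised (N := N) (γ := γ) (κ := κ) 0 x hm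
      rw [hx, seq_zero_apply, zero_im, hunit _ hm, mul_one,
        im_conj_mul_neighbours (hzero N le_rfl) hm, show N - (k + 1) + 1 = N - k by omega,
        ih (by omega)] at h1
      have h2 := baseCurrent_sub (N := N) (γ := γ) (N - (k + 1))
      rw [show N - (k + 1) + 1 = N - k by omega] at h2
      linarith
  have hbond1 : ∀ m < N, normSq (bond x m) = 1 := by
    intro m hm
    cases m with
    | zero => rw [bond, map_mul, normSq_conj, hunit 0 hm, one_mul]
    | succ m => rw [bond, map_mul, normSq_conj, hunit _ hm, hunit m (by omega), one_mul]
  let s : Fin N → Bool := fun i => decide (0 ≤ (bond x i).re)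
  have hbond : ∀ m < N, bond x m = bondValue γ s m := by
    intro m hm
    have him : (bond x m).im = baseCurrent N γ m := by
      have h1 := hcur (N - m) (by omega)
      rw [show N - (N - m) = m by omega, current, if_pos hm] at h1
      exact h1
    have hsq : 1 - baseCurrent N γ m ^ 2 = (bond x m).re ^ 2 := by
      have h1 := hbond1 m hm
      rw [normSq_apply, him] at h1
      linarith
    apply Complex.ext
    · change _ = signAt s m * √(1 - baseCurrent N γ m ^ 2)
      rw [hsq, Real.sqrt_sq_eq_abs]
      by_cases h : 0 ≤ (bond x m).re
      · simp [signAt, hm, s, h, abs_of_nonneg h]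
      · simp [signAt, hm, s, h, abs_of_neg (not_le.1 h)]
    · exact him
  have hfinal : ∀ z : Seq ℕ, (∀ m, N ≤ m → z m = 0) → (∀ m < N, z m ≠ 0) →
      (∀ m < N, bond z m = bondValue γ s m) → (0 < N → z 0 = phase γ s 0) →
      z = baseState γ s := by
    intro z hz hz0 hzb h0
    refine lp.ext (funext fun m => ?_)
    by_cases hm : m < N
    · rw [baseState_of_lt s hm]
      exact eq_of_bond_eq hz0 h0 (fun k hk => (hzb k hk).trans (bond_phase hγ s k).symm) m hm
    · rw [hz m (not_lt.1 hm), baseState_of_le s (not_lt.1 hm)]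
  refine ⟨s, ?_⟩
  -- The central bond determines only the square of the central amplitude; this is the source of the
  -- remaining sign.
  have hroot : 0 < N → x 0 = phase γ s 0 ∨ x 0 = -phase γ s 0 := by
    intro h0
    have h1 := (hbond 0 h0).trans (bond_phase hγ s 0).symm
    rw [bond, bond, ← map_mul, ← map_mul] at h1
    exact mul_self_eq_mul_self_iff.1 ((starRingEnd ℂ).injective h1)
  by_cases h0 : x 0 = phase γ s 0
  · exact Or.inl (hfinal x hzero hx0 hbond fun _ => h0)
  · refine Or.inr (hfinal (-x) (fun m hm => ?_) (fun m hm => ?_) (fun m hm => ?_) fun h => ?_)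
    · rw [seq_neg_apply, hzero m hm, neg_zero]
    · rw [seq_neg_apply]
      exact neg_ne_zero.2 (hx0 m hm)
    · rw [← hbond m hm]
      cases m with
      | zero => simp only [bond, seq_neg_apply, map_neg, neg_mul_neg]
      | succ m => simp only [bond, seq_neg_apply, map_neg, neg_mul_neg]
    · rw [seq_neg_apply, (hroot h).resolve_left h0, neg_neg]

end BaseStates

/-! ### A priori bounds and the compactness argument. -/

section Completeness

variable {N : ℕ} {γ κ : ℝ}

theorem norm_neighbours_le {x : ℕ → ℂ} {M : ℝ} (hM : ∀ m, ‖x m‖ ≤ M) (m : ℕ) :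
    ‖neighbours N κ x m‖ ≤ 2 * (1 + |κ|) * M := by
  have hM0 : 0 ≤ M := (norm_nonneg _).trans (hM 0)
  have h1 : ∀ j k, ‖(coupling N κ j : ℂ) * x k‖ ≤ (1 + |κ|) * M := fun j k => by
    rw [norm_mul]
    exact mul_le_mul (norm_coupling_le N κ j) (hM k) (norm_nonneg _) (by positivity)
  cases m with
  | zero =>
    refine (norm_add_le _ _).trans ?_
    have h2 := h1 0 1
    have h3 : ‖(starRingEnd ℂ) (x 0)‖ ≤ (1 + |κ|) * M := by
      rw [norm_conj]
      nlinarith [hM 0, abs_nonneg κ, mul_nonneg (abs_nonneg κ) hM0]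
    linarith
  | succ m =>
    refine (norm_add_le _ _).trans ?_
    have h2 := h1 (m + 1) (m + 2)
    have h3 := h1 m m
    linarith

theorem norm_gain_le (m : ℕ) : ‖(if m < N then I * gain N γ m else 0 : ℂ)‖ ≤ |γ| := by
  split_ifs
  · simp [gain]
  · simp

/-- The cubic term dominates: with `M` the supremum of the amplitudes, every amplitude satisfies `‖x
m‖ ^ 3 ≤ M * A`, which is incompatible with `M > A ≥ 1`. -/
theorem IsHalfSolution.norm_apply_le {δ : ℝ} (hδ : δ ∈ Set.Ioc (0 : ℝ) 1) {x : Seq ℕ}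
    (hx : IsHalfSolution N γ κ δ x) (m : ℕ) : ‖x m‖ ≤ 1 + 2 * (1 + |κ|) + |γ| := by
  set A : ℝ := 1 + 2 * (1 + |κ|) + |γ| with hA
  have hA1 : 1 ≤ A := by
    have := abs_nonneg κ
    have := abs_nonneg γ
    linarith
  have hbdd : BddAbove (Set.range fun m => ‖x m‖) :=
    ⟨‖x‖, by rintro _ ⟨m, rfl⟩; exact lp.norm_apply_le_norm two_ne_zero x m⟩
  set M : ℝ := ⨆ m, ‖x m‖ with hM
  have hle : ∀ m, ‖x m‖ ≤ M := fun m => le_ciSup hbdd m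
  have hM0 : 0 ≤ M := (norm_nonneg _).trans (hle 0)
  have hcube : ∀ m, ‖x m‖ ^ 3 ≤ M * A := by
    intro m
    have h1 : ((‖x m‖ : ℂ) ^ 2) * x m = x m -
        δ * (neighbours N κ x m + (if m < N then I * gain N γ m else 0) * x m) := by
      rw [← hx m]
      ring
    have h2 := congrArg norm h1
    have h3 : ‖((‖x m‖ : ℂ) ^ 2) * x m‖ = ‖x m‖ ^ 3 := by
      rw [norm_mul, norm_pow, norm_real, norm_norm]
      ring
    rw [h3] at h2
    rw [h2]
    refine (norm_sub_le _ _).trans ?_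
    have h4 : ‖neighbours N κ x m + (if m < N then I * gain N γ m else 0 : ℂ) * x m‖ ≤
        2 * (1 + |κ|) * M + |γ| * M := by
      refine (norm_add_le _ _).trans (add_le_add (norm_neighbours_le hle m) ?_)
      rw [norm_mul]
      exact mul_le_mul (norm_gain_le m) (hle m) (norm_nonneg _) (abs_nonneg γ)
    have h5 : ‖(δ : ℂ) * (neighbours N κ x m +
        (if m < N then I * gain N γ m else 0 : ℂ) * x m)‖ ≤ 1 * (2 * (1 + |κ|) * M + |γ| * M) := by
      rw [norm_mul]
      refine mul_le_mul ?_ h4 (norm_nonneg _) zero_le_one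
      rw [norm_real, Real.norm_eq_abs, abs_of_pos hδ.1]
      exact hδ.2
    have h6 := hle m
    rw [hA]
    linarith
  refine (hle m).trans ?_
  by_contra! hlt
  -- The geometric mean of `M` and `A` lies below `M`, so some amplitude exceeds it. Its cube
  -- exceeds `√(M * A) * (M * A) ≥ M * A`, a contradiction that does not need the supremum to be
  -- attained.
  have h1 : √(M * A) < M := by
    rw [Real.sqrt_lt' (by linarith)]
    nlinarith
  obtain ⟨k, hk⟩ := exists_lt_of_lt_ciSup (hM ▸ h1)
  have h2 : 1 ≤ √(M * A) := by
    rw [Real.one_le_sqrt]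
    nlinarith
  have h3 : √(M * A) ^ 2 = M * A := Real.sq_sqrt (by positivity)
  have h4 := hcube k
  have h5 : √(M * A) ^ 3 < ‖x k‖ ^ 3 := pow_lt_pow_left₀ hk (by linarith) (by norm_num)
  nlinarith [mul_nonneg hM0 (zero_le_one.trans hA1)]

/-- Outside the defect the factor `1 - ‖x m‖ ^ 2` is at least `1 - r ^ 2`, so the equation bounds
the exterior part pointwise by `δ` times the neighbour sum. The comparison passes to `l²` norms and
controls the whole infinite tail. -/
theorem IsHalfSolution.norm_outerL_le {δ r : ℝ} (hδ : 0 ≤ δ) (hr : r ∈ Set.Ioo (0 : ℝ) 1)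
    {x : Seq ℕ} (hx : IsHalfSolution N γ κ δ x) (hout : ∀ m, N ≤ m → ‖x m‖ ≤ r) :
    (1 - r ^ 2) * ‖outerL N x‖ ≤ δ * (‖neighboursL N κ‖ * ‖x‖) := by
  have hr2 : 0 ≤ 1 - r ^ 2 := by nlinarith [hr.1, hr.2]
  have h1 : ‖(1 - r ^ 2) • outerL N x‖ ≤ ‖δ • neighboursL N κ x‖ := by
    refine lp.norm_mono two_ne_zero fun m => ?_
    rw [seq_smul_apply, seq_smul_apply, neighboursL_apply]
    by_cases hm : m < N
    · simp only [outerL, weightL_apply, if_pos hm, zero_mul, mul_zero, norm_zero]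
      positivity
    · have h2 := congrArg norm (hx m)
      rw [if_neg hm, zero_mul, add_zero, norm_mul] at h2
      rw [← h2]
      simp only [outerL, weightL_apply, if_neg hm, one_mul, norm_mul]
      refine mul_le_mul_of_nonneg_right ?_ (norm_nonneg _)
      have h3 : ‖x m‖ ≤ r := hout m (not_lt.1 hm)
      have h4 : (1 - (‖x m‖ : ℂ) ^ 2) = ((1 - ‖x m‖ ^ 2 : ℝ) : ℂ) := by push_cast; rfl
      rw [h4, norm_real, norm_real, Real.norm_of_nonneg hr2]
      refine le_trans ?_ (Real.le_norm_self _)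
      nlinarith [norm_nonneg (x m)]
  rw [norm_smul, norm_smul, Real.norm_of_nonneg hr2, Real.norm_of_nonneg hδ] at h1
  exact h1.trans (mul_le_mul_of_nonneg_left ((neighboursL N κ).le_opNorm x) hδ)

theorem finiteL_add_outerL (x : Seq ℕ) : finiteL N (fun i => x i) + outerL N x = x := by
  refine lp.ext (funext fun m => ?_)
  rw [seq_add_apply, finiteL_apply]
  by_cases hm : m < N
  · simp [outerL, hm]
  · simp [outerL, hm]

theorem IsHalfSolution.neg {δ : ℝ} {x : Seq ℕ} (hx : IsHalfSolution N γ κ δ x) :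
    IsHalfSolution N γ κ δ (-x) := by
  intro m
  have h1 : neighbours N κ (-x : Seq ℕ) m = -neighbours N κ x m := by
    rw [← neighboursL_apply, ← neighboursL_apply, map_neg, seq_neg_apply]
  rw [seq_neg_apply, norm_neg, h1]
  linear_combination -hx m

/-- Every solution with large amplitudes exactly on the defect lies, up to sign, on one of the
branches continued from the anticontinuum limit. -/
theorem eventually_mem_branch (hγ : γ ∈ Set.Ioo (-1 : ℝ) 1)
    {r : ℝ} (hr : r ∈ Set.Ioo (0 : ℝ) 1) (X : (Fin N → Bool) → ℝ → Seq ℕ)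
    (hX : ∀ s, ∀ᶠ p in 𝓝 ((0 : ℝ), baseState γ s), desingularised N γ κ p = 0 → p.2 = X s p.1) :
    ∀ᶠ δ in 𝓝[>] (0 : ℝ), ∀ x : Seq ℕ, IsHalfSolution N γ κ δ x → (∀ m < N, r ≤ ‖x m‖) →
      (∀ m, N ≤ m → ‖x m‖ ≤ r) → ∃ s, x = X s δ ∨ -x = X s δ := by
  -- Otherwise there are parameters tending to zero, taken in `(0, 1]` for the amplitude bound, with
  -- solutions lying on no branch.
  by_contra hcon
  have hfreq := (not_eventually.1 hcon).and_eventually (Ioc_mem_nhdsGT (zero_lt_one (α := ℝ)))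
  obtain ⟨d, hd, hdP⟩ := exists_seq_forall_of_frequently hfreq
  have hd0 : Tendsto d atTop (𝓝 0) := hd.mono_right nhdsWithin_le_nhds
  have hdI : ∀ k, d k ∈ Set.Ioc (0 : ℝ) 1 := fun k => (hdP k).2
  have hex : ∀ k, ∃ x : Seq ℕ, IsHalfSolution N γ κ (d k) x ∧ (∀ m < N, r ≤ ‖x m‖) ∧
      (∀ m, N ≤ m → ‖x m‖ ≤ r) ∧ ¬∃ s, x = X s (d k) ∨ -x = X s (d k) := fun k => by
    have h1 := (hdP k).1
    push Not at h1
    obtain ⟨x, h2, h3, h4, h5⟩ := h1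
    exact ⟨x, h2, h3, h4, fun ⟨s, hs⟩ => hs.elim (h5 s).1 (h5 s).2⟩
  choose x hsol hin hout hnot using hex
  set B : ℝ := 1 + 2 * (1 + |κ|) + |γ| with hB
  have hB0 : 0 ≤ B := by positivity
  have hbound : ∀ k m, ‖x k m‖ ≤ B := fun k m => (hsol k).norm_apply_le (hdI k) m
  let c : ℕ → Fin N → ℂ := fun k i => x k i
  have hc : ∀ k, c k ∈ Metric.closedBall (0 : Fin N → ℂ) B := fun k => by
    rw [mem_closedBall_zero_iff, pi_norm_le_iff_of_nonneg hB0]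
    exact fun i => hbound k i
  -- Only the finitely many defect amplitudes need compactness; the exterior part tends to zero in
  -- norm.
  obtain ⟨a, -, φ, hφ, ha⟩ := tendsto_subseq_of_bounded Metric.isBounded_closedBall hc
  set K : ℝ := ‖neighboursL N κ‖ with hK
  set D : ℝ := ‖finiteL N‖ * B with hD
  have hr2 : 0 < 1 - r ^ 2 := by nlinarith [hr.1, hr.2]
  have houter : Tendsto (fun k => outerL N (x k)) atTop (𝓝 0) := by
    -- The exterior estimate has the full norm on its right-hand side. For small `d k` the exterior
    -- share of it is absorbed into half of the left-hand side.
    have hsmall : ∀ᶠ k in atTop, d k * K < (1 - r ^ 2) / 2 :=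
      (by simpa using hd0.mul_const K : Tendsto (fun k => d k * K) atTop (𝓝 0)).eventually_lt_const
        (by linarith)
    refine squeeze_zero_norm' (a := fun k => d k * (2 * K * D / (1 - r ^ 2))) ?_
      (by simpa using hd0.mul_const (2 * K * D / (1 - r ^ 2)))
    filter_upwards [hsmall] with k hk
    have h1 := (hsol k).norm_outerL_le (hdI k).1.le hr (hout k)
    have h2 : ‖x k‖ ≤ D + ‖outerL N (x k)‖ := by
      conv_lhs => rw [← finiteL_add_outerL (N := N) (x k)]
      refine (norm_add_le _ _).trans (add_le_add_left ?_ _)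
      refine ((finiteL N).le_opNorm _).trans (mul_le_mul_of_nonneg_left ?_ (norm_nonneg _))
      exact mem_closedBall_zero_iff.1 (hc k)
    have h3 : d k * (K * ‖x k‖) ≤ d k * K * D + (1 - r ^ 2) / 2 * ‖outerL N (x k)‖ := by
      have hdK : 0 ≤ d k * K := mul_nonneg (hdI k).1.le (norm_nonneg _)
      nlinarith [norm_nonneg (outerL N (x k))]
    rw [← mul_div_assoc, le_div_iff₀ hr2]
    linarith
  have hlim : Tendsto (fun k => x (φ k)) atTop (𝓝 (finiteL N a)) := by
    have h1 := ((finiteL N).continuous.tendsto a).comp ha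
    have h2 := h1.add (houter.comp hφ.tendsto_atTop)
    rw [add_zero] at h2
    exact h2.congr fun k => finiteL_add_outerL _
  have hdφ : Tendsto (fun k => d (φ k)) atTop (𝓝 0) := hd0.comp hφ.tendsto_atTop
  have hG : ∀ k, ∀ y : Seq ℕ, IsHalfSolution N γ κ (d k) y → (∀ m < N, r ≤ ‖y m‖) →
      desingularised N γ κ (d k, y) = 0 := fun k y hy hy2 =>
    (isHalfSolution_iff_desingularised (hdI k).1.ne'
      fun m hm => norm_pos_iff.1 (hr.1.trans_le (hy2 m hm))).1 hy
  have hcoord : ∀ m, Tendsto (fun k => ‖x (φ k) m‖) atTop (𝓝 ‖finiteL N a m‖) := fun m =>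
    (((lp.evalCLM ℝ (fun _ : ℕ => ℂ) 2 m).continuous.tendsto _).comp hlim).norm
  have hlim0 : desingularised N γ κ (0, finiteL N a) = 0 := by
    refine tendsto_nhds_unique (((contDiff_desingularised N γ κ).continuous.tendsto _).comp
      (hdφ.prodMk_nhds hlim)) ?_
    exact tendsto_const_nhds.congr fun k => (hG _ _ (hsol (φ k)) (hin (φ k))).symm
  obtain ⟨s, hs⟩ := exists_eq_baseState hγ hr hlim0
    (fun m hm => ge_of_tendsto' (hcoord m) fun k => hin (φ k) m hm)
    (fun m hm => le_of_tendsto' (hcoord m) fun k => hout (φ k) m hm)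
  -- Local uniqueness is known only at the chosen representatives, so in the second case the
  -- sequence is negated first.
  rcases hs with hs | hs
  · have h1 := (hdφ.prodMk_nhds (hs ▸ hlim)).eventually (hX s)
    obtain ⟨k, hk⟩ := h1.exists
    exact hnot (φ k) ⟨s, Or.inl (hk (hG _ _ (hsol (φ k)) (hin (φ k))))⟩
  · have h1 := (hdφ.prodMk_nhds (hs ▸ hlim.neg)).eventually (hX s)
    obtain ⟨k, hk⟩ := h1.exists
    refine hnot (φ k) ⟨s, Or.inr (hk (hG _ _ (hsol (φ k)).neg fun m hm => ?_))⟩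
    rw [seq_neg_apply, norm_neg]
    exact hin (φ k) m hm

end Completeness

/-! ### Unfolding the half-line to the lattice and to the finite chain. -/

section Reflection

variable (N : ℕ)

/-- The PT-symmetric sequence on `ℤ` determined by its values on the half-line. -/
def reflect (x : ℕ → ℂ) (n : ℤ) : ℂ :=
  if n ≤ N then x (N - n).toNat else (starRingEnd ℂ) (x (n - N - 1).toNat)

variable {N}

theorem reflect_left (x : ℕ → ℂ) (m : ℕ) : reflect N x (N - m) = x m := by
  rw [reflect, if_pos (by omega)]
  congr 1
  omega

theorem reflect_right (x : ℕ → ℂ) (m : ℕ) : reflect N x (N + 1 + m) = (starRingEnd ℂ) (x m) := by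
  rw [reflect, if_neg (by omega)]
  congr 2
  omega

theorem exists_site (n : ℤ) : ∃ m : ℕ, n = N - m ∨ n = N + 1 + m := by
  by_cases h : n ≤ N
  · exact ⟨(N - n).toNat, Or.inl (by omega)⟩
  · exact ⟨(n - N - 1).toNat, Or.inr (by omega)⟩

theorem mem_sites_left (m : ℕ) : (N - m : ℤ) ∈ sites N ↔ m < N := by
  rw [sites, Finset.mem_Icc]
  omega

theorem mem_sites_right (m : ℕ) : (N + 1 + m : ℤ) ∈ sites N ↔ m < N := by
  rw [sites, Finset.mem_Icc]
  omega

theorem isPTSymmetric_reflect (x : ℕ → ℂ) : IsPTSymmetric N (reflect N x) := by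
  funext n
  simp only [parity]
  obtain ⟨m, rfl | rfl⟩ := exists_site (N := N) n
  · rw [show (2 * (N : ℤ) + 1 - (N - m)) = N + 1 + m by ring, reflect_left, reflect_right,
      conj_conj]
  · rw [show (2 * (N : ℤ) + 1 - (N + 1 + m)) = N - m by ring, reflect_left, reflect_right]

theorem IsPTSymmetric.conj_apply {u : ℤ → ℂ} (hu : IsPTSymmetric N u) (n : ℤ) :
    (starRingEnd ℂ) (u n) = u (2 * N + 1 - n) := by
  have h := congrFun hu (2 * N + 1 - n)
  simp only [parity, sub_sub_cancel] at h
  exact h.symm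

theorem IsPTSymmetric.eq_reflect {u : ℤ → ℂ} (hu : IsPTSymmetric N u) :
    u = reflect N fun m => u (N - m) := by
  funext n
  obtain ⟨m, rfl | rfl⟩ := exists_site (N := N) n
  · rw [reflect_left]
  · rw [reflect_right, hu.conj_apply]
    congr 1
    ring

/-- The defect of a sequence from being a stationary state of the lattice, at a given site. -/
def residual (N : ℕ) (γ δ : ℝ) (u : ℤ → ℂ) (n : ℤ) : ℂ :=
  (1 - (‖u n‖ : ℂ) ^ 2) * u n -
    (δ : ℂ) * (u (n + 1) + u (n - 1) +
      Complex.I * (γ : ℂ) * (-1 : ℂ) ^ n * (if n ∈ sites N then 1 else 0) * u n)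

theorem isLatticeSolution_iff {γ δ : ℝ} {W : Lattice} :
    IsLatticeSolution N γ δ W ↔ ∀ n, residual N γ δ W n = 0 :=
  forall_congr' fun _ => sub_eq_zero.symm

theorem isChainSolution_iff {γ δ : ℝ} {V : Chain N} :
    IsChainSolution N γ δ V ↔ ∀ n ∈ sites N, residual N γ δ (zeroExtend V) n = 0 := by
  refine forall₂_congr fun n hn => ?_
  rw [residual, if_pos hn, mul_one, sub_eq_zero]

theorem neg_one_zpow_sub (N m : ℕ) : (-1 : ℂ) ^ ((N : ℤ) - m) = (-1) ^ (N + m) := by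
  rw [zpow_sub₀ (by norm_num), pow_add, zpow_natCast, zpow_natCast, div_eq_mul_inv, ← inv_pow]
  norm_num

theorem residual_reflect_left {γ δ : ℝ} (x : ℕ → ℂ) (m : ℕ) :
    residual N γ δ (reflect N x) (N - m) = (1 - (‖x m‖ : ℂ) ^ 2) * x m -
      δ * (neighbours N 1 x m + (if m < N then I * gain N γ m else 0) * x m) := by
  have h1 : reflect N x (N - m + 1) + reflect N x (N - m - 1) = neighbours N 1 x m := by
    rw [show (N - m - 1 : ℤ) = N - (m + 1 : ℕ) by push_cast; ring, reflect_left]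
    cases m with
    | zero =>
      rw [show ((N : ℤ) - (0 : ℕ) + 1) = N + 1 + (0 : ℕ) by push_cast; ring, reflect_right]
      simp [neighbours, coupling_one]
      ring
    | succ m =>
      rw [show ((N : ℤ) - (m + 1 : ℕ) + 1) = N - m by push_cast; ring, reflect_left]
      simp [neighbours, coupling_one]
      ring
  rw [residual, h1, reflect_left, neg_one_zpow_sub]
  simp only [mem_sites_left]
  congr 3
  split_ifs
  · simp only [gain]
    push_cast
    ring
  · simp

/-- Reflection about the centre reverses the sign of `(-1) ^ n`, and conjugation reverses that of
`i`. The gain and loss term is thus PT-symmetric, and the equations on the right half are conjugates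
of those on the left. -/
theorem residual_reflect_right {γ δ : ℝ} (x : ℕ → ℂ) (m : ℕ) :
    residual N γ δ (reflect N x) (N + 1 + m) =
      (starRingEnd ℂ) (residual N γ δ (reflect N x) (N - m)) := by
  have hpt := isPTSymmetric_reflect (N := N) x
  have hs : (-1 : ℂ) ^ ((N : ℤ) + 1 + m) = -(-1) ^ ((N : ℤ) - m) := by
    rw [neg_one_zpow_sub, show ((N : ℤ) + 1 + m) = ((N + m + 1 : ℕ) : ℤ) by push_cast; ring,
      zpow_natCast, pow_succ]
    ring
  have hc : (starRingEnd ℂ) ((-1 : ℂ) ^ ((N : ℤ) - m)) = (-1) ^ ((N : ℤ) - m) := by simp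
  simp only [residual, mem_sites_left, mem_sites_right, map_sub, map_mul, map_add, map_pow,
    map_one, conj_ofReal, conj_I, hpt.conj_apply, hs, hc]
  rw [show (2 * (N : ℤ) + 1 - (N - m)) = N + 1 + m by ring,
    show (2 * (N : ℤ) + 1 - (N - m + 1)) = N + 1 + m - 1 by ring,
    show (2 * (N : ℤ) + 1 - (N - m - 1)) = N + 1 + m + 1 by ring, reflect_left, reflect_right,
    norm_conj]
  split_ifs
  · rw [map_one]
    ring
  · rw [map_zero]
    ring

theorem residual_reflect_eq_zero {γ δ : ℝ} {x : ℕ → ℂ} :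
    (∀ n, residual N γ δ (reflect N x) n = 0) ↔
      ∀ m : ℕ, residual N γ δ (reflect N x) (N - m) = 0 := by
  refine ⟨fun h m => h _, fun h n => ?_⟩
  obtain ⟨m, rfl | rfl⟩ := exists_site (N := N) n
  · exact h m
  · rw [residual_reflect_right, h m, map_zero]

theorem residual_reflect_eq_zero_on_sites {γ δ : ℝ} {x : ℕ → ℂ} :
    (∀ n ∈ sites N, residual N γ δ (reflect N x) n = 0) ↔
      ∀ m < N, residual N γ δ (reflect N x) (N - m) = 0 := by
  refine ⟨fun h m hm => h _ ((mem_sites_left m).2 hm), fun h n hn => ?_⟩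
  obtain ⟨m, rfl | rfl⟩ := exists_site (N := N) n
  · exact h m ((mem_sites_left m).1 hn)
  · rw [residual_reflect_right, h m ((mem_sites_right m).1 hn), map_zero]

theorem supportedOnDefect_reflect {r : ℝ} {x : ℕ → ℂ} :
    SupportedOnDefect N r (reflect N x) ↔
      (∀ m < N, r ≤ ‖x m‖) ∧ ∀ m, N ≤ m → ‖x m‖ ≤ r := by
  constructor
  · rintro ⟨h1, h2⟩
    refine ⟨fun m hm => ?_, fun m hm => ?_⟩
    · simpa only [reflect_left] using h1 _ ((mem_sites_left m).2 hm)
    · simpa only [reflect_left] using h2 (N - m) ((mem_sites_left m).not.2 (not_lt.2 hm))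
  · rintro ⟨h1, h2⟩
    refine ⟨fun n hn => ?_, fun n hn => ?_⟩
    · obtain ⟨m, rfl | rfl⟩ := exists_site (N := N) n
      · rw [reflect_left]
        exact h1 m ((mem_sites_left m).1 hn)
      · rw [reflect_right, norm_conj]
        exact h1 m ((mem_sites_right m).1 hn)
    · obtain ⟨m, rfl | rfl⟩ := exists_site (N := N) n
      · rw [reflect_left]
        exact h2 m (not_lt.1 ((mem_sites_left m).not.1 hn))
      · rw [reflect_right, norm_conj]
        exact h2 m (not_lt.1 ((mem_sites_right m).not.1 hn))

theorem gaugeEquiv_refl (u : ℤ → ℂ) : GaugeEquiv u u := ⟨0, fun n => by simp⟩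

theorem gaugeEquiv_of_eq_neg {u v : ℤ → ℂ} (h : ∀ n, u n = -v n) : GaugeEquiv u v :=
  ⟨Real.pi, fun n => by rw [h n, mul_comm I, exp_pi_mul_I, neg_one_mul]⟩

theorem GaugeEquiv.conj_mul_eq {u v : ℤ → ℂ} (h : GaugeEquiv u v) (k n : ℤ) :
    (starRingEnd ℂ) (u k) * u n = (starRingEnd ℂ) (v k) * v n := by
  obtain ⟨α, hα⟩ := h
  have h1 : (starRingEnd ℂ) (exp (I * α)) * exp (I * α) = 1 := by
    rw [← normSq_eq_conj_mul_self, normSq_eq_norm_sq, mul_comm, norm_exp_ofReal_mul_I]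
    simp
  rw [hα k, hα n, map_mul]
  linear_combination ((starRingEnd ℂ) (v k) * v n) * h1

theorem bond_eq_conj_mul (x : ℕ → ℂ) (m : ℕ) :
    bond x m = (starRingEnd ℂ) (reflect N x (N - m)) * reflect N x (N - m + 1) := by
  rw [reflect_left]
  cases m with
  | zero =>
    rw [show ((N : ℤ) - (0 : ℕ) + 1) = N + 1 + (0 : ℕ) by push_cast; ring, reflect_right, bond]
  | succ m => rw [show ((N : ℤ) - (m + 1 : ℕ) + 1) = N - m by push_cast; ring, reflect_left, bond]

/-- Bond products are conjugate products of neighbouring amplitudes on the lattice, where a common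
phase cancels. They serve as the invariants telling branches apart. -/
theorem GaugeEquiv.bond_eq {x y : ℕ → ℂ} (h : GaugeEquiv (reflect N x) (reflect N y)) (m : ℕ) :
    bond x m = bond y m := by
  rw [bond_eq_conj_mul (N := N), bond_eq_conj_mul (N := N), h.conj_mul_eq]

variable (N) in
theorem leftSite_injective : Function.Injective fun m : ℕ => (N : ℤ) - m :=
  fun a b h => by simpa using h

variable (N) in
theorem rightSite_injective : Function.Injective fun m : ℕ => (N : ℤ) + 1 + m :=
  fun a b h => by simpa using h

variable (N) in
/-- The operator `reflect` from the half-line to the lattice. -/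
def reflectL : Seq ℕ →L[ℝ] Lattice :=
  pushL _ (leftSite_injective N) +
    pushL _ (rightSite_injective N) ∘L conjL ℕ

theorem reflectL_coe (x : Seq ℕ) : (reflectL N x : ℤ → ℂ) = reflect N x := by
  funext n
  change pushL _ (leftSite_injective N) x n +
    pushL _ (rightSite_injective N) (conjL ℕ x) n = _
  obtain ⟨m, rfl | rfl⟩ := exists_site (N := N) n
  · rw [pushL_apply_of_notMem _ (rightSite_injective N) _ _
      (by rintro ⟨k, hk⟩; omega), add_zero, reflect_left]
    exact pushL_apply_self _ (leftSite_injective N) x m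
  · rw [pushL_apply_of_notMem _ (leftSite_injective N) _ _
      (by rintro ⟨k, hk⟩; omega), zero_add, reflect_right]
    exact pushL_apply_self _ (rightSite_injective N) (conjL ℕ x) m

variable (N) in
/-- The vector on the finite chain determined by a sequence on the half-line. -/
def chainL : Seq ℕ →L[ℝ] Chain N :=
  ((PiLp.continuousLinearEquiv 2 ℝ (fun _ : sites N => ℂ)).symm : _ →L[ℝ] Chain N) ∘L
    .pi fun n : sites N => lp.evalCLM ℝ (fun _ : ℤ => ℂ) 2 (n : ℤ) ∘L reflectL N

theorem chainL_apply (x : Seq ℕ) (n : sites N) : chainL N x n = reflect N x n := by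
  rw [← reflectL_coe]
  rfl

theorem innerL_apply_of_lt (x : Seq ℕ) {m : ℕ} (hm : m < N) : innerL N x m = x m := by
  simp [innerL, hm]

theorem innerL_apply_of_le (x : Seq ℕ) {m : ℕ} (hm : N ≤ m) : innerL N x m = 0 := by
  simp [innerL, not_lt.2 hm]

theorem zeroExtend_chainL (x : Seq ℕ) : zeroExtend (chainL N x) = reflectL N (innerL N x) := by
  refine lp.ext (funext fun n => ?_)
  rw [reflectL_coe]
  change (if h : n ∈ sites N then chainL N x ⟨n, h⟩ else 0) = _
  obtain ⟨m, rfl | rfl⟩ := exists_site (N := N) n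
  · split_ifs with h
    · rw [chainL_apply, reflect_left, reflect_left, innerL_apply_of_lt x ((mem_sites_left m).1 h)]
    · rw [reflect_left, innerL_apply_of_le x (not_lt.1 ((mem_sites_left m).not.1 h))]
  · split_ifs with h
    · rw [chainL_apply, reflect_right, reflect_right,
        innerL_apply_of_lt x ((mem_sites_right m).1 h)]
    · rw [reflect_right, innerL_apply_of_le x (not_lt.1 ((mem_sites_right m).not.1 h)), map_zero]

theorem zeroExtend_of_notMem (V : Chain N) {n : ℤ} (h : n ∉ sites N) : zeroExtend V n = 0 :=
  dif_neg h

/-- The restriction of a sequence on the lattice to the half-line. -/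
def restrictHalf (N : ℕ) (U : Lattice) : Seq ℕ :=
  pullL _ (leftSite_injective N) U

theorem reflectL_restrictHalf {U : Lattice} (hU : IsPTSymmetric N U) :
    reflectL N (restrictHalf N U) = U := by
  refine lp.ext ?_
  rw [reflectL_coe]
  exact hU.eq_reflect.symm

theorem isLatticeSolution_reflectL {γ δ : ℝ} {x : Seq ℕ} :
    IsLatticeSolution N γ δ (reflectL N x) ↔ IsHalfSolution N γ 1 δ x := by
  rw [isLatticeSolution_iff, reflectL_coe, residual_reflect_eq_zero]
  refine forall_congr' fun m => ?_
  rw [residual_reflect_left, sub_eq_zero]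

/-- Truncation to the defect and cutting the edge bond have the same effect on sites of the defect.
This is what identifies the finite chain with `κ = 0`. -/
theorem neighbours_inner (x : Seq ℕ) {m : ℕ} (hm : m < N) :
    neighbours N 1 (innerL N x) m = neighbours N 0 x m := by
  have h1 : (coupling N 1 m : ℂ) * innerL N x (m + 1) = coupling N 0 m * x (m + 1) := by
    by_cases h : m + 1 = N
    · rw [innerL_apply_of_le x h.ge, coupling, coupling, if_pos h, if_pos h]
      simp
    · rw [innerL_apply_of_lt x (by omega), coupling_of_ne N 1 h, coupling_of_ne N 0 h]
  cases m with
  | zero => rw [neighbours, neighbours, h1, innerL_apply_of_lt x hm]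
  | succ m =>
    rw [neighbours, neighbours, h1, innerL_apply_of_lt x (show m < N by omega),
      coupling_of_ne N 1 (show m + 1 ≠ N by omega), coupling_of_ne N 0 (show m + 1 ≠ N by omega)]

theorem isChainSolution_chainL {γ δ : ℝ} {x : Seq ℕ} :
    IsChainSolution N γ δ (chainL N x) ↔ ∀ m < N, (1 - (‖x m‖ : ℂ) ^ 2) * x m =
      δ * (neighbours N 0 x m + (if m < N then I * gain N γ m else 0) * x m) := by
  rw [isChainSolution_iff, zeroExtend_chainL, reflectL_coe, residual_reflect_eq_zero_on_sites]
  refine forall₂_congr fun m hm => ?_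
  rw [residual_reflect_left, sub_eq_zero, innerL_apply_of_lt x hm, neighbours_inner x hm]

theorem neighbours_zero_of_le {x : ℕ → ℂ} (hx : ∀ m, N ≤ m → x m = 0) (hN : 1 ≤ N) {m : ℕ}
    (hm : N ≤ m) : neighbours N 0 x m = 0 := by
  cases m with
  | zero => omega
  | succ m =>
    rw [neighbours, hx (m + 2) (by omega)]
    by_cases h : m + 1 = N
    · simp [coupling, h]
    · rw [hx m (by omega)]
      simp

/-- With the edge bond cut, exterior sites see only zeros. Since `N ≥ 1`, the self-coupling across
the axis belongs to the defect. -/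
theorem isHalfSolution_of_isChainSolution (hN : 1 ≤ N) {γ δ : ℝ} {x : Seq ℕ}
    (hx : ∀ m, N ≤ m → x m = 0) (h : IsChainSolution N γ δ (chainL N x)) :
    IsHalfSolution N γ 0 δ x := by
  intro m
  by_cases hm : m < N
  · exact isChainSolution_chainL.1 h m hm
  · rw [hx m (not_lt.1 hm), neighbours_zero_of_le hx hN (not_lt.1 hm)]
    simp

end Reflection

/-! ### Branches on the half-line, uniform estimates, and transfer to the original problems. -/

section Branches

variable {N : ℕ} {γ : ℝ}

/-- The complete family of branches continued from the anticontinuum limit on the half-line. -/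
structure IsHalfBranches (N : ℕ) (γ κ : ℝ) (X : (Fin N → Bool) → ℝ → Seq ℕ) : Prop where
  base : ∀ s, X s 0 = baseState γ s
  smooth : ∀ s, ContDiffAt ℝ ω (X s) 0
  solution : ∀ᶠ δ in 𝓝[>] (0 : ℝ), ∀ s, IsHalfSolution N γ κ δ (X s δ)
  distinct : ∀ᶠ δ in 𝓝[>] (0 : ℝ), ∀ s s',
    (∀ m < N, bond (X s δ) m = bond (X s' δ) m) → s = s'
  supported : ∀ r ∈ Set.Ioo (0 : ℝ) 1, ∀ᶠ δ in 𝓝[>] (0 : ℝ), ∀ s,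
    (∀ m < N, r ≤ ‖X s δ m‖) ∧ ∀ m, N ≤ m → ‖X s δ m‖ ≤ r
  complete : ∀ r ∈ Set.Ioo (0 : ℝ) 1, ∀ᶠ δ in 𝓝[>] (0 : ℝ), ∀ x : Seq ℕ,
    IsHalfSolution N γ κ δ x → (∀ m < N, r ≤ ‖x m‖) → (∀ m, N ≤ m → ‖x m‖ ≤ r) →
      ∃ s, x = X s δ ∨ -x = X s δ

theorem norm_baseState (hγ : γ ∈ Set.Ioo (-1 : ℝ) 1) (s : Fin N → Bool) {m : ℕ} (hm : m < N) :
    ‖baseState γ s m‖ = 1 := by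
  have h := normSq_phase hγ s m
  rw [normSq_eq_norm_sq] at h
  rw [baseState_of_lt s hm]
  exact (pow_eq_one_iff_of_nonneg (norm_nonneg _) two_ne_zero).1 h

theorem norm_apply_sub_le (x y : Seq ℕ) (m : ℕ) : ‖x m - y m‖ ≤ ‖x - y‖ :=
  lp.norm_apply_le_norm two_ne_zero (x - y) m

theorem continuousAt_bond {X : ℝ → Seq ℕ} (hX : ContinuousAt X 0) (m : ℕ) :
    ContinuousAt (fun δ => bond (X δ) m) 0 := by
  have h : ∀ k, ContinuousAt (fun δ => X δ k) 0 := fun k =>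
    (lp.evalCLM ℝ (fun _ : ℕ => ℂ) 2 k).continuous.continuousAt.comp hX
  have hc : ∀ k, ContinuousAt (fun δ => (starRingEnd ℂ) (X δ k)) 0 := fun k =>
    continuous_conj.continuousAt.comp (h k)
  cases m with
  | zero => exact (hc 0).mul (hc 0)
  | succ m => exact (hc (m + 1)).mul (h m)

theorem exists_isHalfBranches (hN : 1 ≤ N) (hγ : γ ∈ Set.Ioo (-1 : ℝ) 1) (κ : ℝ) :
    ∃ X, IsHalfBranches N γ κ X := by
  choose X h0 hsm hsol huniq using fun s : Fin N → Bool =>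
    (isBaseState_baseState (κ := κ) hγ s).exists_branch hN
  have hcont : ∀ s, ContinuousAt (X s) 0 := fun s => (hsm s).continuousAt
  have hsupp : ∀ r ∈ Set.Ioo (0 : ℝ) 1, ∀ᶠ δ in 𝓝[>] (0 : ℝ), ∀ s,
      (∀ m < N, r ≤ ‖X s δ m‖) ∧ ∀ m, N ≤ m → ‖X s δ m‖ ≤ r := by
    intro r hr
    refine eventually_all.2 fun s => nhdsWithin_le_nhds ?_
    -- Limit amplitudes are 1 inside and 0 outside: a deviation below `1 - r` keeps the former above
    -- `r`, and one below `r` keeps the latter below `r`.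
    have hε : 0 < min r (1 - r) := lt_min hr.1 (sub_pos.2 hr.2)
    filter_upwards [Metric.continuousAt_iff'.1 (hcont s) _ hε] with δ hδ
    rw [h0, dist_eq_norm] at hδ
    refine ⟨fun m hm => ?_, fun m hm => ?_⟩
    · have h1 := norm_apply_sub_le (X s δ) (baseState γ s) m
      have h2 := norm_sub_norm_le (baseState γ s m) (X s δ m)
      rw [norm_baseState hγ s hm, norm_sub_rev] at h2
      have h3 := min_le_right r (1 - r)
      linarith
    · have h1 := norm_apply_sub_le (X s δ) (baseState γ s) m
      rw [baseState_of_le s hm, sub_zero] at h1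
      have h3 := min_le_left r (1 - r)
      linarith
  refine ⟨X, h0, hsm, ?_, ?_, hsupp, fun r hr => eventually_mem_branch hγ hr X huniq⟩
  · have h1 : ∀ᶠ δ in 𝓝[>] (0 : ℝ), ∀ s, desingularised N γ κ (δ, X s δ) = 0 :=
      nhdsWithin_le_nhds (eventually_all.2 hsol)
    filter_upwards [h1, hsupp (1 / 2) (by norm_num), self_mem_nhdsWithin] with δ h1 h2 h3 s
    refine (isHalfSolution_iff_desingularised (ne_of_gt h3) fun m hm => ?_).2 (h1 s)
    exact norm_pos_iff.1 (lt_of_lt_of_le (by norm_num) ((h2 s).1 m hm))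
  · refine eventually_all.2 fun s => eventually_all.2 fun s' => nhdsWithin_le_nhds ?_
    by_cases hs : s = s'
    · exact Eventually.of_forall fun _ _ => hs
    -- Distinct sign patterns differ in some bond at `δ = 0`, and by continuity that bond still
    -- differs for small `δ`.
    · obtain ⟨m, hm, hne⟩ : ∃ m < N, bondValue γ s m ≠ bondValue γ s' m := by
        by_contra! hcon
        exact hs (bondValue_injective hγ hcon)
      have hne' : bond (X s 0) m ≠ bond (X s' 0) m := by
        rwa [h0, h0, bond_baseState hγ s hm, bond_baseState hγ s' hm]
      filter_upwards [((continuousAt_bond (hcont s) m).sub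
        (continuousAt_bond (hcont s') m)).eventually_ne (sub_ne_zero.2 hne')] with δ hδ h
      exact absurd (h m hm) (sub_ne_zero.1 hδ)

/-- A function differentiable at 0 and vanishing there is `O(δ)`; finiteness of the index set makes
the constant uniform. Both the norm bound and the closeness estimate come from this. -/
theorem exists_forall_norm_le_mul {ι E : Type*} [Finite ι] [NormedAddCommGroup E]
    [NormedSpace ℝ E] {f : ι → ℝ → E} (hf : ∀ i, DifferentiableAt ℝ (f i) 0)
    (h0 : ∀ i, f i 0 = 0) :
    ∃ C : ℝ, 0 < C ∧ ∀ᶠ δ in 𝓝[>] (0 : ℝ), ∀ i, ‖f i δ‖ ≤ C * δ := by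
  have h1 : ∀ i, ∃ c : ℝ, ∀ᶠ δ in 𝓝[>] (0 : ℝ), ‖f i δ‖ ≤ c * δ := by
    intro i
    obtain ⟨c, hc⟩ := (hf i).isBigO_sub.bound
    refine ⟨c, ?_⟩
    filter_upwards [nhdsWithin_le_nhds hc, self_mem_nhdsWithin] with δ hδ hpos
    rw [h0, sub_zero, sub_zero, Real.norm_of_nonneg (le_of_lt hpos)] at hδ
    exact hδ
  choose c hc using h1
  obtain ⟨C, hC⟩ := (Set.finite_range c).bddAbove
  refine ⟨max C 1, by positivity, ?_⟩
  filter_upwards [eventually_all.2 hc, self_mem_nhdsWithin] with δ hδ hpos i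
  refine (hδ i).trans (mul_le_mul_of_nonneg_right ?_ (le_of_lt hpos))
  exact (hC ⟨i, rfl⟩).trans (le_max_left _ _)

theorem norm_reflect_of_mem {x : ℕ → ℂ} {a : ℝ} (hx : ∀ m < N, ‖x m‖ = a) {n : ℤ}
    (hn : n ∈ sites N) : ‖reflect N x n‖ = a := by
  obtain ⟨m, rfl | rfl⟩ := exists_site (N := N) n
  · rw [reflect_left, hx m ((mem_sites_left m).1 hn)]
  · rw [reflect_right, norm_conj, hx m ((mem_sites_right m).1 hn)]

theorem innerL_eq_self {x : Seq ℕ} (hx : ∀ m, N ≤ m → x m = 0) : innerL N x = x := by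
  refine lp.ext (funext fun m => ?_)
  by_cases hm : m < N
  · rw [innerL_apply_of_lt x hm]
  · rw [innerL_apply_of_le x (not_lt.1 hm), hx m (not_lt.1 hm)]

theorem gaugeEquiv_reflectL {x y : Seq ℕ} (h : x = y ∨ -x = y) :
    GaugeEquiv (reflectL N x) (reflectL N y) := by
  rcases h with rfl | rfl
  · exact gaugeEquiv_refl _
  · refine gaugeEquiv_of_eq_neg fun n => ?_
    rw [map_neg]
    exact (neg_neg _).symm

theorem exists_Ioc_of_eventually {p : ℝ → Prop} (h : ∀ᶠ δ in 𝓝[>] (0 : ℝ), p δ) {δ₀ : ℝ}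
    (hδ₀ : 0 < δ₀) : ∃ δ₁ ∈ Set.Ioc 0 δ₀, ∀ δ ∈ Set.Ioo 0 δ₁, p δ := by
  obtain ⟨ε, hε, hp⟩ := mem_nhdsGT_iff_exists_Ioo_subset.1 h
  exact ⟨min ε δ₀, ⟨lt_min hε hδ₀, min_le_right _ _⟩,
    fun δ hδ => hp ⟨hδ.1, hδ.2.trans_le (min_le_left _ _)⟩⟩

/-- Analyticity at a point persists in a two-sided neighbourhood, so smoothness holds up to the
endpoint 0. -/
theorem exists_contDiffOn_Ico {ι E : Type*} [Finite ι] [NormedAddCommGroup E] [NormedSpace ℝ E]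
    {f : ι → ℝ → E} (hf : ∀ i, ContDiffAt ℝ ω (f i) 0) :
    ∃ ε > 0, ∀ i, ∀ δ₀ ≤ ε, ContDiffOn ℝ ∞ (f i) (Set.Ico 0 δ₀) := by
  have h1 : ∀ᶠ δ in 𝓝 (0 : ℝ), ∀ i, ContDiffAt ℝ ω (f i) δ :=
    eventually_all.2 fun i => (hf i).eventually (by simp)
  obtain ⟨ε, hε, h⟩ := Metric.eventually_nhds_iff.1 h1
  refine ⟨ε, hε, fun i δ₀ hδ₀ δ hδ => ?_⟩
  refine ((h ?_ i).of_le le_top).contDiffWithinAt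
  rw [Real.dist_0_eq_abs, abs_of_nonneg hδ.1]
  exact hδ.2.trans_le hδ₀

theorem supportedOnDefect_chainL {r : ℝ} (hr : 0 ≤ r) {x : Seq ℕ} (hx : ∀ m < N, r ≤ ‖x m‖) :
    SupportedOnDefect N r (zeroExtend (chainL N x)) := by
  rw [zeroExtend_chainL, reflectL_coe, supportedOnDefect_reflect]
  refine ⟨fun m hm => ?_, fun m hm => ?_⟩
  · rw [innerL_apply_of_lt x hm]
    exact hx m hm
  · rw [innerL_apply_of_le x hm, norm_zero]
    exact hr

theorem exists_gaugeEquiv_chainL (hN : 1 ≤ N) {δ r : ℝ} {Z : (Fin N → Bool) → Seq ℕ}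
    (hZ : ∀ x : Seq ℕ, IsHalfSolution N γ 0 δ x → (∀ m < N, r ≤ ‖x m‖) →
      (∀ m, N ≤ m → ‖x m‖ ≤ r) → ∃ s, x = Z s ∨ -x = Z s)
    {U : Chain N} (hU : IsChainSolution N γ δ U) (hpt : IsPTSymmetric N (zeroExtend U))
    (hr : SupportedOnDefect N r (zeroExtend U)) :
    ∃ s, GaugeEquiv (zeroExtend U) (zeroExtend (chainL N (Z s))) := by
  set x := restrictHalf N (zeroExtend U) with hxdef
  have hx : reflectL N x = zeroExtend U := reflectL_restrictHalf hpt
  have hx0 : ∀ m, N ≤ m → x m = 0 := fun m hm =>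
    zeroExtend_of_notMem U ((mem_sites_left m).not.2 (not_lt.2 hm))
  have hinner : innerL N x = x := innerL_eq_self hx0
  have hsol : IsChainSolution N γ δ (chainL N x) := by
    rw [isChainSolution_iff] at hU ⊢
    rwa [zeroExtend_chainL, hinner, hx]
  rw [← hx, reflectL_coe, supportedOnDefect_reflect] at hr
  obtain ⟨s, hs⟩ := hZ x (isHalfSolution_of_isChainSolution hN hx0 hsol) hr.1 hr.2
  refine ⟨s, ?_⟩
  rw [zeroExtend_chainL, ← hx]
  refine gaugeEquiv_reflectL (hs.imp (fun h => ?_) fun h => ?_)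
  · rw [← h, hinner]
  · rw [← h, map_neg, hinner]

theorem exists_gaugeEquiv_reflectL {δ r : ℝ} {Z : (Fin N → Bool) → Seq ℕ}
    (hZ : ∀ x : Seq ℕ, IsHalfSolution N γ 1 δ x → (∀ m < N, r ≤ ‖x m‖) →
      (∀ m, N ≤ m → ‖x m‖ ≤ r) → ∃ s, x = Z s ∨ -x = Z s)
    {U : Lattice} (hU : IsLatticeSolution N γ δ U) (hpt : IsPTSymmetric N U)
    (hr : SupportedOnDefect N r U) : ∃ s, GaugeEquiv U (reflectL N (Z s)) := by
  have hx : reflectL N (restrictHalf N U) = U := reflectL_restrictHalf hpt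
  rw [← hx] at hU hr
  rw [reflectL_coe, supportedOnDefect_reflect] at hr
  obtain ⟨s, hs⟩ := hZ _ (isLatticeSolution_reflectL.1 hU) hr.1 hr.2
  rw [← hx]
  exact ⟨s, gaugeEquiv_reflectL hs⟩

theorem sum_norm_sq_chainL_baseState (hγ : γ ∈ Set.Ioo (-1 : ℝ) 1) (s : Fin N → Bool) :
    ∑ n, ‖chainL N (baseState γ s) n‖ ^ 2 = 2 * (N : ℝ) := by
  have h1 : ∀ n : sites N, ‖chainL N (baseState γ s) n‖ ^ 2 = 1 := fun n => by
    rw [chainL_apply, norm_reflect_of_mem (fun m hm => norm_baseState hγ s hm) n.2, one_pow]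
  rw [Finset.sum_congr rfl fun n _ => h1 n, Finset.sum_const, Finset.card_univ, Fintype.card_coe,
    sites, Int.card_Icc, nsmul_eq_mul, mul_one]
  rw [show (2 * (N : ℤ) + 1 - 1).toNat = 2 * N by omega]
  push_cast
  rfl

theorem differentiableAt_sum_norm_sq {V : ℝ → Chain N} (hV : DifferentiableAt ℝ V 0) :
    DifferentiableAt ℝ (fun δ => ∑ n, ‖V δ n‖ ^ 2 - 2 * (N : ℝ)) 0 := by
  refine DifferentiableAt.sub_const (DifferentiableAt.fun_sum fun n _ => ?_) _
  exact DifferentiableAt.norm_sq ℝ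
    ((PiLp.proj (𝕜 := ℝ) 2 (fun _ : sites N => ℂ) n).differentiableAt.comp (0 : ℝ) hV)

end Branches

end PTdNLS

end

/-! ### Assembly of the theorem. -/

theorem mainTheorem2 (N : ℕ) (hN : 1 ≤ N) (γ : ℝ) (hγ : γ ∈ Set.Ioo (-1 : ℝ) 1) :
    ∃ (δ₀ C : ℝ) (V : Fin (2 ^ N) → ℝ → PTdNLS.Chain N)
      (W : Fin (2 ^ N) → ℝ → PTdNLS.Lattice),
      0 < δ₀ ∧ 0 < C ∧
      PTdNLS.IsChainBranches N γ δ₀ C V ∧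
      PTdNLS.IsSolitonBranches N γ δ₀ W ∧
      ∀ j, ∀ δ ∈ Set.Ioo 0 δ₀, ‖W j δ - PTdNLS.zeroExtend (V j δ)‖ ≤ C * δ := by
  open PTdNLS Filter Topology in
  obtain ⟨X, hX⟩ := exists_isHalfBranches hN hγ 0
  obtain ⟨Y, hY⟩ := exists_isHalfBranches hN hγ 1
  let e : Fin (2 ^ N) ≃ (Fin N → Bool) := (Fintype.equivFinOfCardEq (by simp)).symm
  let V : Fin (2 ^ N) → ℝ → Chain N := fun j δ => chainL N (X (e j) δ)
  let W : Fin (2 ^ N) → ℝ → Lattice := fun j δ => reflectL N (Y (e j) δ)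
  have hVsm : ∀ j, ContDiffAt ℝ ω (V j) 0 := fun j =>
    (chainL N).contDiff.contDiffAt.comp (0 : ℝ) (hX.smooth (e j))
  have hWsm : ∀ j, ContDiffAt ℝ ω (W j) 0 := fun j =>
    (reflectL N).contDiff.contDiffAt.comp (0 : ℝ) (hY.smooth (e j))
  have hω : (ω : WithTop ℕ∞) ≠ 0 := by simp
  obtain ⟨C₁, hC₁, hbound⟩ := exists_forall_norm_le_mul
    (f := fun j δ => ∑ n, ‖V j δ n‖ ^ 2 - 2 * (N : ℝ))
    (fun j => differentiableAt_sum_norm_sq ((hVsm j).differentiableAt hω))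
    (fun j => by
      simp only [V, hX.base]
      rw [sum_norm_sq_chainL_baseState hγ, sub_self])
  -- The zero extension of a chain vector retains only the defect part of the half-line branch,
  -- hence `innerL`. The two branches have the same supported base state, so the difference vanishes
  -- at `δ = 0`.
  obtain ⟨C₂, hC₂, hclose⟩ := exists_forall_norm_le_mul
    (f := fun j δ => reflectL N (Y (e j) δ - innerL N (X (e j) δ)))
    (fun j => (reflectL N).differentiableAt.comp (0 : ℝ)
      (((hY.smooth (e j)).differentiableAt hω).sub
        ((innerL N).differentiableAt.comp (0 : ℝ) ((hX.smooth (e j)).differentiableAt hω))))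
    (fun j => by
      simp only [hX.base, hY.base]
      rw [innerL_eq_self fun m hm => baseState_of_le (e j) hm, sub_self, map_zero])
  obtain ⟨ε₁, hε₁, hV⟩ := exists_contDiffOn_Ico hVsm
  obtain ⟨ε₂, hε₂, hW⟩ := exists_contDiffOn_Ico hWsm
  obtain ⟨δ₀, ⟨hδ₀, hle⟩, h⟩ := exists_Ioc_of_eventually
    (hX.solution.and (hX.distinct.and (hY.solution.and (hY.distinct.and (hbound.and hclose)))))
    (lt_min hε₁ hε₂)
  refine ⟨δ₀, C₁ + C₂, V, W, hδ₀, by positivity, ?_, ?_, ?_⟩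
  · refine ⟨fun j => hV j δ₀ (hle.trans (min_le_left _ _)), fun j δ hδ => ?_, fun j δ hδ => ?_,
      fun j δ hδ => ?_, fun j k δ hδ hg => ?_, fun r hr => ?_⟩
    · exact isChainSolution_chainL.2 fun m _ => (h δ hδ).1 (e j) m
    · change IsPTSymmetric N (zeroExtend (chainL N _))
      rw [zeroExtend_chainL, reflectL_coe]
      exact isPTSymmetric_reflect _
    · refine ((h δ hδ).2.2.2.2.1 j).trans ?_
      exact mul_le_mul_of_nonneg_right (by linarith) hδ.1.le
    · change GaugeEquiv (zeroExtend (chainL N _)) (zeroExtend (chainL N _)) at hg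
      rw [zeroExtend_chainL, zeroExtend_chainL, reflectL_coe, reflectL_coe] at hg
      refine e.injective ((h δ hδ).2.1 _ _ fun m hm => ?_)
      have h1 := hg.bond_eq m
      rwa [bond_congr (fun k hk => innerL_apply_of_lt _ hk) hm,
        bond_congr (fun k hk => innerL_apply_of_lt _ hk) hm] at h1
    · obtain ⟨δ₁, hδ₁, h₁⟩ := exists_Ioc_of_eventually
        ((hX.supported r hr).and (hX.complete r hr)) hδ₀
      refine ⟨δ₁, hδ₁, fun δ hδ => ⟨fun j => ?_, fun U hU hpt hs => ?_⟩⟩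
      · exact supportedOnDefect_chainL hr.1.le ((h₁ δ hδ).1 (e j)).1
      · obtain ⟨s, hs⟩ := exists_gaugeEquiv_chainL hN (h₁ δ hδ).2 hU hpt hs
        refine ⟨e.symm s, ?_⟩
        simpa only [V, e.apply_symm_apply] using hs
  · refine ⟨fun j => hW j δ₀ (hle.trans (min_le_right _ _)), fun j δ hδ => ?_, fun j δ hδ => ?_,
      fun j k δ hδ hg => ?_, fun r hr => ?_⟩
    · exact isLatticeSolution_reflectL.2 ((h δ hδ).2.2.1 (e j))
    · change IsPTSymmetric N (reflectL N _)
      rw [reflectL_coe]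
      exact isPTSymmetric_reflect _
    · change GaugeEquiv (reflectL N _) (reflectL N _) at hg
      rw [reflectL_coe, reflectL_coe] at hg
      exact e.injective ((h δ hδ).2.2.2.1 _ _ fun m _ => hg.bond_eq m)
    · obtain ⟨δ₁, hδ₁, h₁⟩ := exists_Ioc_of_eventually
        ((hY.supported r hr).and (hY.complete r hr)) hδ₀
      refine ⟨δ₁, hδ₁, fun δ hδ => ⟨fun j => ?_, fun U hU hpt hs => ?_⟩⟩
      · change SupportedOnDefect N r (reflectL N _)
        rw [reflectL_coe]
        exact supportedOnDefect_reflect.2 ((h₁ δ hδ).1 (e j))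
      · obtain ⟨s, hs⟩ := exists_gaugeEquiv_reflectL (h₁ δ hδ).2 hU hpt hs
        refine ⟨e.symm s, ?_⟩
        simpa only [W, e.apply_symm_apply] using hs
  · intro j δ hδ
    change ‖reflectL N _ - zeroExtend (chainL N _)‖ ≤ _
    rw [zeroExtend_chainL, ← map_sub]
    refine ((h δ hδ).2.2.2.2.2 j).trans ?_
    exact mul_le_mul_of_nonneg_right (by linarith) hδ.1.le
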